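/- **Lemma (many-to-two).** Let $D\subset\mathbb R^3$ be non-empty, open, bounded and convex, let $V=\{\upsilon\in\mathbb R^3: \upsilon_{\min}\le|\upsilon|\le \upsilon_{\max}\}$ with $0<\upsilon_{\min}<\upsilon_{\max}<\infty$, and let $\sigma_{\mathtt s},\sigma_{\mathtt f}:D\times V\to[0,\infty)$ and $\pi_{\mathtt s},\pi_{\mathtt f}:D\times V\times V\to[0,\infty)$ be bounded measurable functions with $\int_V\pi_{\mathtt s}(r,\upsilon,\upsilon')\,d\upsilon'=1$. For $(r,\upsilon)\in D\times V$ let $\mathcal P_{(r,\upsilon)}$, with expectation $\mathcal E_{(r,\upsilon)}$, be the law (depending measurably on $(r,\upsilon)$) of a random finite family of velocities $\upsilon_1,\dots,\upsilon_N\in V$, $N\ge 0$, such that $\mathcal E_{(r,\upsilon)}[\sum_{i=1}^N h(\upsilon_i)]=\int_V h(\upsilon')\pi_{\mathtt f}(r,\upsilon,\upsilon')\,d\upsilon'$ for all measurable $h\ge 0$. Let $X_t=\sum_{i=1}^{N_t}\delta_{(r_i(t),\upsilon_i(t))}$, $t\ge0$, be the neutron branching process issued from one neutron at $(r,\upsilon)\in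 D\times V$, under $\mathbb P_{\delta_{(r,\upsilon)}}$: a neutron at $r$ with velocity $\upsilon$ moves along $r+\upsilon t$; it is killed when it leaves $D$; independently of all else it scatters at a time $T_{\mathtt s}$ with $\Pr(T_{\mathtt s}>t)=\exp(-\int_0^t\sigma_{\mathtt s}(r+\upsilon s,\upsilon)\,ds)$ and undergoes fission at an independent time $T_{\mathtt f}$ with $\Pr(T_{\mathtt f}>t)=\exp(-\int_0^t\sigma_{\mathtt f}(r+\upsilon s,\upsilon)\,ds)$, as long as it has stayed in $D$, whichever comes first. At a scattering at $(r,\upsilon)$ its velocity is replaced by $\upsilon'$ with probability $\pi_{\mathtt s}(r,\upsilon,\upsilon')\,d\upsilon'$; at a fission at $(r,\upsilon)$ it is replaced by neutrons at $r$ with velocities $\upsilon_1,\dots,\upsilon_N$ of law $\mathcal P_{(r,\upsilon)}$; the new neutrons evolve independently in the same way. For measurable $h,k:D\times V\to[0,\infty]$ write $\psi_t[h](r,\upsilon)=\mathbb E_{\delta_{(r,\upsilon)}}[\langle h,X_t\rangle]$, where $\langle h,X_t\rangle=\sum_{i=1}^{N_t}h(r_i(t),\upsilon_i(t))$, and $$\eta_{\mathtt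 f}[h,k](r,\upsilon)=\sigma_{\mathtt f}(r,\upsilon)\,\mathcal E_{(r,\upsilon)}\Big[\sum_{i,j=1,\,i\ne j}^N h(r,\upsilon_i)\,k(r,\upsilon_j)\Big].$$ Then for all bounded measurable $f,g:D\times V\to[0,\infty)$, all $t\ge 0$ and all $(r,\upsilon)\in D\times V$, $$\mathbb E_{\delta_{(r,\upsilon)}}\big[\langle f,X_t\rangle\langle g,X_t\rangle\big]=\psi_t[fg](r,\upsilon)+\int_0^t\psi_s\Big[\eta_{\mathtt f}\big[\psi_{t-s}[f],\psi_{t-s}[g]\big]\Big](r,\upsilon)\,ds$$ as an identity in $[0,\infty]$. If moreover the numbers $N$ of fission neutrons are bounded by a constant, almost surely under every $\mathcal P_{(r,\upsilon)}$, then both sides are finite. -/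

import Mathlib

open MeasureTheory ProbabilityTheory
open scoped ENNReal NNReal

namespace Neutron

/-- Physical space. -/
abbrev Space : Type := EuclideanSpace ℝ (Fin 3)

/-- A configuration variable `(r, v)`: a position and a velocity. -/
abbrev Phase : Type := Space × Space

/-- Finite families of velocities `v₀, …, v_{N-1}`, where `N` may be `0`. -/
abbrev Velocities : Type := Σ N : ℕ, (Fin N → Space)

/-- A Borel structure for the topology of the disjoint union. -/
instance instBorelSpaceVelocities : BorelSpace Velocities := by
  refine ⟨le_antisymm ?_ ?_⟩
  · intro s hs
    have hs' : ∀ n : ℕ, MeasurableSet ((@Sigma.mk ℕ (fun m => Fin m → Space) n) ⁻¹' s) :=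
      fun n => MeasurableSpace.measurableSet_iInf.1 hs n
    have hunion : s = ⋃ n : ℕ, (@Sigma.mk ℕ (fun m => Fin m → Space) n) ''
        ((@Sigma.mk ℕ (fun m => Fin m → Space) n) ⁻¹' s) := by
      ext ⟨n, z⟩
      simp only [Set.mem_iUnion, Set.mem_image, Set.mem_preimage]
      constructor
      · intro h
        exact ⟨n, z, h, rfl⟩
      · rintro ⟨m, y, hy, he⟩
        rw [← he]
        exact hy
    rw [hunion]
    let _ : MeasurableSpace Velocities := borel Velocities
    have _ : BorelSpace Velocities := ⟨rfl⟩
    exact MeasurableSet.iUnion fun n =>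
      (Topology.IsOpenEmbedding.sigmaMk.measurableEmbedding).measurableSet_image.2 (hs' n)
  · refine MeasurableSpace.generateFrom_le fun s hs => ?_
    refine MeasurableSpace.measurableSet_iInf.2 fun n => ?_
    exact (IsOpen.preimage continuous_sigmaMk hs).measurableSet

instance instPolishSpaceVelocities : PolishSpace Velocities := by
  let _ := Metric.Sigma.metricSpace (E := fun n : ℕ => (Fin n → Space))
  have _ : CompleteSpace Velocities := Metric.Sigma.completeSpace
  infer_instance

/-- The velocity space `V = {v : vmin ≤ |v| ≤ vmax}`. -/
def velocitySpace (vmin vmax : ℝ) : Set Space := {v | vmin ≤ ‖v‖ ∧ ‖v‖ ≤ vmax}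

/-- The data of a neutron branching process on `D × V`. Functions and laws on `D × V` are given by
(arbitrary) measurable extensions to the ambient space; conditions are imposed on `D × V` only. -/
structure Model where
  /-- the physical domain -/
  D : Set Space
  /-- the minimal speed -/
  vmin : ℝ
  /-- the maximal speed -/
  vmax : ℝ
  /-- the scattering rate -/
  σs : Phase → ℝ≥0
  /-- the fission rate -/
  σf : Phase → ℝ≥0
  /-- the density of the new velocity after a scattering -/
  πs : Phase → Space → ℝ≥0
  /-- the density of the mean number of fission neutrons -/
  πf : Phase → Space → ℝ≥0
  /-- the law `𝒫_(r,v)` of the velocities released by a fission at `r` with incoming velocity `v` -/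
  fission : Kernel Phase Velocities
  nonempty_D : D.Nonempty
  isOpen_D : IsOpen D
  convex_D : Convex ℝ D
  isBounded_D : Bornology.IsBounded D
  vmin_pos : 0 < vmin
  vmin_lt_vmax : vmin < vmax
  measurable_σs : Measurable σs
  measurable_σf : Measurable σf
  measurable_πs : Measurable (Function.uncurry πs)
  measurable_πf : Measurable (Function.uncurry πf)
  isMarkovKernel_fission : IsMarkovKernel fission
  lintegral_πs : ∀ x ∈ D ×ˢ velocitySpace vmin vmax,
    ∫⁻ v' in velocitySpace vmin vmax, (πs x v' : ℝ≥0∞) = 1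
  /-- `∫_V h(v') πf(r, v, v') dv' = 𝓔_(r,v)[∑ᵢ h(vᵢ)]` -/
  lintegral_πf : ∀ x ∈ D ×ˢ velocitySpace vmin vmax, ∀ h : Space → ℝ≥0∞, Measurable h →
    ∫⁻ v' in velocitySpace vmin vmax, h v' * (πf x v' : ℝ≥0∞) =
      ∫⁻ z, ∑ i, h (z.2 i) ∂(fission x)

namespace Model

variable (M : Model)

/-- The velocity space. -/
def V : Set Space := velocitySpace M.vmin M.vmax

/-- The configuration space `D × V`. -/
def domain : Set Phase := M.D ×ˢ M.V

/-- The cross-sections `σs`, `σf`, `πs`, `πf` are uniformly bounded. -/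
def BoundedCrossSections : Prop :=
  ∃ C : ℝ≥0, ∀ x ∈ M.domain, M.σs x ≤ C ∧ M.σf x ≤ C ∧ ∀ v' ∈ M.V, M.πs x v' ≤ C ∧ M.πf x v' ≤ C

/-- The number of fission neutrons is bounded by a constant. -/
def BoundedOffspring : Prop :=
  ∃ nmax : ℕ, ∀ x ∈ M.domain, ∀ᵐ z ∂(M.fission x), z.1 ≤ nmax

theorem measurableSet_V : MeasurableSet M.V :=
  ((isClosed_le continuous_const continuous_norm).inter
    (isClosed_le continuous_norm continuous_const)).measurableSet

theorem measurableSet_domain : MeasurableSet M.domain :=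
  M.isOpen_D.measurableSet.prod M.measurableSet_V

open Classical in
/-- The law `πs(r, v, v') dv'` on `V` of the new velocity after a scattering at `(r, v) ∈ D × V`
(and a Dirac mass, never used, outside `D × V`). -/
noncomputable def scattering : Kernel Phase Space :=
  Kernel.piecewise M.measurableSet_domain
    (Kernel.withDensity (Kernel.const Phase (volume.restrict M.V)) fun x v' => (M.πs x v' : ℝ≥0∞))
    (Kernel.const Phase (Measure.dirac 0))

instance instIsMarkovKernelScattering : IsMarkovKernel M.scattering := by
  classical
  refine ⟨fun x => ⟨?_⟩⟩
  have hm : Measurable (Function.uncurry fun (x : Phase) (v' : Space) => (M.πs x v' : ℝ≥0∞)) :=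
    measurable_coe_nnreal_ennreal.comp M.measurable_πs
  unfold scattering
  rw [Kernel.piecewise_apply]
  split_ifs with hx
  · rw [Kernel.withDensity_apply' _ hm]
    simpa [V] using M.lintegral_πs x hx
  · simp

instance instIsMarkovKernelFission : IsMarkovKernel M.fission := M.isMarkovKernel_fission

end Model

/-- A measurable map `S` such that `S x U` has law `κ x` when `U` is uniform on `[0, 1]`. -/
noncomputable def sampler {Y : Type} [Nonempty Y] [MeasurableSpace Y] [StandardBorelSpace Y]
    (κ : Kernel Phase Y) [IsMarkovKernel κ] : Phase → unitInterval → Y :=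
  Classical.choose (Kernel.exists_measurable_map_eq_unitInterval κ)

theorem measurable_sampler {Y : Type} [Nonempty Y] [MeasurableSpace Y] [StandardBorelSpace Y]
    (κ : Kernel Phase Y) [IsMarkovKernel κ] : Measurable (Function.uncurry (sampler κ)) :=
  (Classical.choose_spec (Kernel.exists_measurable_map_eq_unitInterval κ)).1

theorem map_sampler {Y : Type} [Nonempty Y] [MeasurableSpace Y] [StandardBorelSpace Y]
    (κ : Kernel Phase Y) [IsMarkovKernel κ] (x : Phase) :
    (volume : Measure unitInterval).map (sampler κ x) = κ x :=
  (Classical.choose_spec (Kernel.exists_measurable_map_eq_unitInterval κ)).2 x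

instance instNonemptyVelocities : Nonempty Velocities := ⟨⟨0, Fin.elim0⟩⟩

/-- `inf {t : ∫₀ᵗ rate(s) ds > e}`. For a standard exponential `e` this is a random time `T` with
`Pr(T > t) = exp(-∫₀ᵗ rate(s) ds)` for as long as the integral is finite. -/
noncomputable def clock (rate : ℝ → ℝ≥0) (e : ℝ) : ℝ≥0∞ :=
  ⨅ (t : ℝ) (_ : 0 ≤ t ∧ ENNReal.ofReal e < ∫⁻ s in Set.Ioc 0 t, (rate s : ℝ≥0∞)), ENNReal.ofReal t

/-- The randomness of one neutron: the exponential variables of its scattering and fission clocks,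
and a uniform variable that selects the outgoing velocities. -/
abbrev Noise : Type := ℝ × ℝ × unitInterval

/-- The three components are independent. -/
noncomputable def noiseLaw : Measure Noise :=
  (expMeasure 1).prod ((expMeasure 1).prod volume)

instance instIsProbabilityMeasureNoiseLaw : IsProbabilityMeasure noiseLaw := by
  have _ : IsProbabilityMeasure (expMeasure 1) := isProbabilityMeasure_expMeasure one_pos
  unfold noiseLaw
  infer_instance

/-- Neutrons are labelled by finite sequences: the root `[]` is the initial one, and the label
`u ++ [i]` is that of the `i`-th neutron which replaces neutron `u` at its scattering (`i = 0` only)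
or fission. The sample space carries one independent noise per label. -/
abbrev Sample : Type := List ℕ → Noise

/-- The probability measure on the sample space: independent noises. -/
noncomputable def sampleLaw : Measure Sample := Measure.infinitePi fun _ => noiseLaw

namespace Model

variable (M : Model)

/-- `κ_(r,v) = inf {t > 0 : r + v t ∉ D}`, the exit time from `D`. -/
noncomputable def exitTime (x : Phase) : ℝ≥0∞ :=
  ⨅ (t : ℝ) (_ : 0 < t ∧ x.1 + t • x.2 ∉ M.D), ENNReal.ofReal t

/-- The scattering time of a neutron issued from `x`. -/
noncomputable def scatterTime (x : Phase) (n : Noise) : ℝ≥0∞ :=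
  clock (fun s => M.σs (x.1 + s • x.2, x.2)) n.1

/-- The fission time of a neutron issued from `x`. -/
noncomputable def fissionTime (x : Phase) (n : Noise) : ℝ≥0∞ :=
  clock (fun s => M.σf (x.1 + s • x.2, x.2)) n.2.1

/-- The time at which a neutron issued from `x` scatters, undergoes fission or leaves `D`. -/
noncomputable def lifetime (x : Phase) (n : Noise) : ℝ≥0∞ :=
  min (min (M.scatterTime x n) (M.fissionTime x n)) (M.exitTime x)

/-- The location at the end of the life. -/
noncomputable def endPoint (x : Phase) (n : Noise) : Space :=
  x.1 + (M.lifetime x n).toReal • x.2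

open Classical in
/-- The velocities that come out at the end of the life: one velocity with law `πs` after a
scattering, a family with law `𝒫` after a fission, none after an exit from `D`. -/
noncomputable def outgoing (x : Phase) (n : Noise) : Velocities :=
  if M.exitTime x ≤ min (M.scatterTime x n) (M.fissionTime x n) then ⟨0, Fin.elim0⟩
  else if M.scatterTime x n < M.fissionTime x n then
    ⟨1, fun _ => sampler M.scattering (M.endPoint x n, x.2) n.2.2⟩
  else sampler M.fission (M.endPoint x n, x.2) n.2.2

/-- `M.neutron u b x ω` is the birth time and the initial configuration of the neutron with label
`u` in the family tree of a neutron born at time `b` with configuration `x`, or `none` if there is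
no such neutron. -/
noncomputable def neutron : List ℕ → ℝ → Phase → Sample → Option (ℝ × Phase)
  | [], b, x, _ => some (b, x)
  | i :: u, b, x, ω =>
    if h : i < (M.outgoing x (ω [])).1 then
      neutron u (b + (M.lifetime x (ω [])).toReal)
        (M.endPoint x (ω []), (M.outgoing x (ω [])).2 ⟨i, h⟩) (fun w => ω (i :: w))
    else none

open Classical in
/-- The neutron branching process `X_t = ∑ δ_(rᵢ(t), vᵢ(t))`, a sum over the neutrons alive at time
`t`, issued from a single neutron with configuration `x`. -/
noncomputable def X (t : ℝ) (x : Phase) (ω : Sample) : Measure Phase :=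
  Measure.sum fun u : List ℕ =>
    match M.neutron u 0 x ω with
    | none => 0
    | some (b, y) =>
      if b ≤ t ∧ ENNReal.ofReal (t - b) < M.lifetime y (ω u) then
        Measure.dirac (y.1 + (t - b) • y.2, y.2)
      else 0

/-- The expectation semigroup `ψ_t[h](x) = 𝔼_{δ_x}[⟨h, X_t⟩]`. -/
noncomputable def ψ (t : ℝ) (h : Phase → ℝ≥0∞) (x : Phase) : ℝ≥0∞ :=
  ∫⁻ ω, (∫⁻ y, h y ∂(M.X t x ω)) ∂sampleLaw

/-- `η_f[h, k](r, v) = σf(r, v) 𝓔_(r,v)[∑_{i ≠ j} h(r, vᵢ) k(r, vⱼ)]`. -/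
noncomputable def η (h k : Phase → ℝ≥0∞) (x : Phase) : ℝ≥0∞ :=
  (M.σf x : ℝ≥0∞) *
    ∫⁻ z, (∑ i, ∑ j, if i ≠ j then h (x.1, z.2 i) * k (x.1, z.2 j) else 0) ∂(M.fission x)

end Model

end Neutron

/-! The proof compares two recursions over generations, entirely in [0,∞], so that neither
finiteness of moments nor a uniqueness theorem is needed. Let `W n` be the part of ⟨h, X_t⟩ carried
by neutrons of generation less than n, and let `mean n` and `second n` be its first and mixed second
moments.

Cut the family tree at the end of the life of the initial neutron. The initial neutron and its
successors are never alive together, so the product of the two sums has only three parts: the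
initial neutron with itself, two neutrons in the same subtree, and two neutrons in distinct
subtrees. Distinct subtrees are independent of each other and of the root, so the third part becomes
a product of means. This is `second_succ`: `second (n + 1)` equals a term of the initial neutron,
plus `branch` of `second n`, plus `pairs` of the truncated means.

Siblings arise only by fission. The explicit law of a first event that is a fission
(`lintegral_fission`, which rests on the law of an inhomogeneous exponential clock,
`lintegral_clock`) turns `pairs` into a time integral along the flight, with integrand the survival
probability times η_f (`pairs_eq`). By translation invariance of Lebesgue measure, the right-hand
side of the formula, truncated to `duhamel n`, obeys the same recursion with this integral as source
(`duhamel_succ`).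

The two recursions differ only in that the first contains truncated means and the second full ones.
Hence `second n` ≤ `duhamel n` by induction. The untruncated second moment satisfies its recursion
with full means, so it dominates every `duhamel n`. Monotone convergence in n gives equality
(`second_eq_duhamel`).

For bounded offspring numbers, a pathwise inequality (`first_add_le`) shows that means grow at most
exponentially. Then η_f of the means is bounded on [0,t], and the formula itself gives a finite
second moment. -/

namespace Neutron

/-! ### Exponential clocks with a variable rate -/

/-- The fundamental theorem of calculus for `t ↦ exp (-∫₀ᵗ ρ)` with a bounded rate `ρ`. -/
theorem integral_rate_mul_exp_neg {ρ : ℝ → ℝ} (hρ : Measurable ρ) {C : ℝ} (h0 : ∀ x, 0 ≤ ρ x)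
    (hC : ∀ x, ρ x ≤ C) {b : ℝ} (hb : 0 ≤ b) :
    ∫ x in (0 : ℝ)..b, ρ x * Real.exp (-∫ u in (0 : ℝ)..x, ρ u) =
      1 - Real.exp (-∫ u in (0 : ℝ)..b, ρ u) := by
  have hint : ∀ x y, IntervalIntegrable ρ volume x y := fun x y => by
    refine (intervalIntegrable_const (c := C)).mono_fun hρ.aestronglyMeasurable ?_
    refine Filter.Eventually.of_forall fun z => ?_
    simp only [Real.norm_eq_abs]
    rw [abs_of_nonneg (h0 z)]
    exact (hC z).trans (le_abs_self C)
  have hC0 : 0 ≤ C := (h0 0).trans (hC 0)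
  set F : ℝ → ℝ := fun x => ∫ u in (0 : ℝ)..x, ρ u with hF
  have hdiff : ∀ x y, F y - F x = ∫ u in x..y, ρ u := fun x y =>
    intervalIntegral.integral_interval_sub_left (hint _ _) (hint _ _)
  have hF0 : ∀ x, 0 ≤ x → 0 ≤ F x := fun x hx =>
    intervalIntegral.integral_nonneg hx fun u _ => h0 u
  have key : ∀ x y, 0 ≤ x → x ≤ y →
      |Real.exp (-F x) - Real.exp (-F y)| ≤ C * (y - x) := by
    intro x y hx hxy
    have h1 : 0 ≤ F y - F x := by
      rw [hdiff]; exact intervalIntegral.integral_nonneg hxy fun u _ => h0 u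
    have h2 : F y - F x ≤ C * (y - x) := by
      rw [hdiff]
      have := intervalIntegral.integral_mono_on hxy (hint x y)
        (intervalIntegrable_const (c := C)) fun u _ => hC u
      simpa [mul_comm] using this
    have h3 : Real.exp (-F y) = Real.exp (-F x) * Real.exp (-(F y - F x)) := by
      rw [← Real.exp_add]; ring_nf
    have h4 := Real.one_sub_le_exp_neg (F y - F x)
    have h5 : Real.exp (-F x) ≤ 1 := Real.exp_le_one_iff.2 (by linarith [hF0 x hx])
    have h6 : Real.exp (-(F y - F x)) ≤ 1 := Real.exp_le_one_iff.2 (by linarith)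
    have h7 := Real.exp_pos (-F x)
    rw [h3, abs_of_nonneg (by nlinarith)]
    nlinarith
  -- As ρ is only bounded and measurable, the chain rule is available almost everywhere only. The
  -- Lipschitz bound supplies the absolute continuity under which the derivative still integrates to
  -- the increment.
  have hlip : LipschitzOnWith (Real.toNNReal C) (fun x => Real.exp (-F x)) (Set.uIcc 0 b) := by
    refine LipschitzOnWith.of_dist_le_mul fun x hx y hy => ?_
    rw [Set.uIcc_of_le hb] at hx hy
    rw [Real.coe_toNNReal _ hC0, Real.dist_eq, Real.dist_eq]
    rcases le_total x y with h | h
    · rw [abs_sub_comm x y, abs_of_nonneg (sub_nonneg.2 h)]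
      exact key x y hx.1 h
    · rw [abs_sub_comm, abs_of_nonneg (sub_nonneg.2 h)]
      exact key y x hy.1 h
  have hftc := hlip.absolutelyContinuousOnInterval.integral_deriv_eq_sub
  have hder : ∫ x in (0 : ℝ)..b, deriv (fun x => Real.exp (-F x)) x =
      ∫ x in (0 : ℝ)..b, -(ρ x * Real.exp (-F x)) := by
    refine intervalIntegral.integral_congr_ae ?_
    filter_upwards [(hint 0 b).ae_hasDerivAt_integral] with x hx hx'
    have h1 := hx (Set.uIoc_subset_uIcc hx') 0 (by simp)
    have h2 := (h1.neg.exp).deriv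
    simp only [Pi.neg_apply] at h2
    change deriv (fun x => Real.exp (-F x)) x = _ at h2
    rw [h2]
    ring
  rw [hder, intervalIntegral.integral_neg] at hftc
  have hF00 : F 0 = 0 := by simp [hF]
  rw [hF00] at hftc
  simp only [neg_zero, Real.exp_zero] at hftc
  linarith

/-- The integrated rate. -/
noncomputable def cumulative (rate : ℝ → ℝ≥0) (t : ℝ) : ℝ≥0∞ :=
  ∫⁻ s in Set.Ioc 0 t, (rate s : ℝ≥0∞)

theorem cumulative_mono (rate : ℝ → ℝ≥0) : Monotone (cumulative rate) := fun _ _ h =>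
  lintegral_mono_set (Set.Ioc_subset_Ioc_right h)

theorem cumulative_of_nonpos (rate : ℝ → ℝ≥0) {t : ℝ} (ht : t ≤ 0) : cumulative rate t = 0 := by
  simp [cumulative, Set.Ioc_eq_empty (not_lt.2 ht)]

/-- The integrated rate is continuous from the left, by monotone convergence along (0, s - s/(n+1)]
↑ (0, s). So if it exceeds e at s, it already does so strictly before s. No bound on the rate is
needed. Measurability and law of the clock are both read off from this equivalence. -/
theorem clock_lt_ofReal_iff (rate : ℝ → ℝ≥0) (e s : ℝ) :
    clock rate e < ENNReal.ofReal s ↔ ENNReal.ofReal e < cumulative rate s := by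
  unfold clock
  simp only [iInf_lt_iff]
  constructor
  · rintro ⟨t, ⟨_, h⟩, hts⟩
    exact lt_of_lt_of_le h (cumulative_mono rate (ENNReal.lt_ofReal_iff_toReal_lt
      (ENNReal.ofReal_ne_top) |>.1 hts |>.le |> fun h' => by
        rwa [ENNReal.toReal_ofReal ‹_›] at h'))
  · intro h
    have hs : 0 < s := by
      by_contra hs
      rw [cumulative_of_nonpos rate (not_lt.1 hs)] at h
      exact not_lt_zero h
    have hU : Set.Ioo 0 s = ⋃ n : ℕ, Set.Ioc 0 (s - s / (n + 1)) := by
      ext y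
      simp only [Set.mem_Ioo, Set.mem_iUnion, Set.mem_Ioc]
      constructor
      · rintro ⟨h1, h2⟩
        obtain ⟨n, hn⟩ := exists_nat_gt (s / (s - y))
        refine ⟨n, h1, ?_⟩
        have h3 : 0 < s - y := sub_pos.2 h2
        rw [div_lt_iff₀ h3] at hn
        have h4 : s / (n + 1) ≤ s - y := by
          rw [div_le_iff₀ (by positivity)]
          nlinarith
        linarith
      · rintro ⟨n, h1, h2⟩
        have : 0 < s / ((n : ℝ) + 1) := by positivity
        exact ⟨h1, by linarith⟩
    have hmono : Monotone fun n : ℕ => Set.Ioc 0 (s - s / ((n : ℝ) + 1)) := by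
      intro m n hmn
      refine Set.Ioc_subset_Ioc_right ?_
      have : s / ((n : ℝ) + 1) ≤ s / ((m : ℝ) + 1) := by gcongr
      linarith
    have h' : ENNReal.ofReal e < ∫⁻ u in Set.Ioo 0 s, (rate u : ℝ≥0∞) := by
      rwa [setLIntegral_congr Ioo_ae_eq_Ioc]
    rw [hU, setLIntegral_iUnion_of_directed _ (hmono.directed_le)] at h'
    obtain ⟨n, hn⟩ := lt_iSup_iff.1 h'
    refine ⟨s - s / (n + 1), ⟨?_, hn⟩, ?_⟩
    · have : s / ((n : ℝ) + 1) ≤ s := div_le_self hs.le (by simp)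
      linarith
    · have : 0 < s / ((n : ℝ) + 1) := by positivity
      exact (ENNReal.ofReal_lt_ofReal_iff hs).2 (by linarith)

theorem measurable_of_lt_ofReal {α : Type*} [MeasurableSpace α] {f : α → ℝ≥0∞}
    (h : ∀ s : ℝ, MeasurableSet {a | f a < ENNReal.ofReal s}) : Measurable f := by
  refine measurable_of_Iio fun a => ?_
  by_cases ha : a = ∞
  · have : f ⁻¹' Set.Iio a = ⋃ n : ℕ, {y | f y < ENNReal.ofReal n} := by
      ext y
      simp only [ha, Set.mem_preimage, Set.mem_Iio, Set.mem_iUnion, Set.mem_ofPred_eq,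
        ENNReal.ofReal_natCast]
      exact ⟨fun h => ENNReal.exists_nat_gt h.ne, fun ⟨n, hn⟩ => hn.trans_le le_top⟩
    rw [this]
    exact MeasurableSet.iUnion fun n => h n
  · have := h a.toReal
    rwa [ENNReal.ofReal_toReal ha] at this

theorem measurable_cumulative {α : Type*} [MeasurableSpace α] {rate : α → ℝ → ℝ≥0}
    (h : Measurable (Function.uncurry rate)) (s : ℝ) :
    Measurable fun a => cumulative (rate a) s := by
  unfold cumulative
  exact Measurable.lintegral_prod_right
    (f := fun a u => (rate a u : ℝ≥0∞)) h.coe_nnreal_ennreal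

theorem measurable_clock {α : Type*} [MeasurableSpace α] {rate : α → ℝ → ℝ≥0}
    (h : Measurable (Function.uncurry rate)) :
    Measurable fun p : α × ℝ => clock (rate p.1) p.2 := by
  refine measurable_of_lt_ofReal fun s => ?_
  simp only [clock_lt_ofReal_iff]
  exact measurableSet_lt measurable_snd.ennreal_ofReal
    ((measurable_cumulative h s).comp measurable_fst)

theorem measurable_clock_right (rate : ℝ → ℝ≥0) :
    Measurable (clock rate) := by
  refine measurable_of_lt_ofReal fun s => ?_
  simp only [clock_lt_ofReal_iff]
  exact measurableSet_lt measurable_id.ennreal_ofReal measurable_const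

theorem expMeasure_Iic {a : ℝ} (ha : 0 ≤ a) :
    expMeasure 1 (Set.Iic a) = ENNReal.ofReal (1 - Real.exp (-a)) := by
  have := isProbabilityMeasure_expMeasure one_pos
  have h := cdf_expMeasure_eq one_pos a
  rw [cdf_eq_real, if_pos ha, one_mul] at h
  rw [← h, ofReal_measureReal]

instance instNullSingletonClassExpMeasure : NullSingletonClass (expMeasure 1) :=
  ⟨fun x => withDensity_absolutelyContinuous _ _ (measure_singleton x)⟩

theorem expMeasure_Iio {a : ℝ} (ha : 0 ≤ a) :
    expMeasure 1 (Set.Iio a) = ENNReal.ofReal (1 - Real.exp (-a)) := by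
  rw [← expMeasure_Iic ha, measure_congr Iio_ae_eq_Iic]

theorem expMeasure_Ioi {a : ℝ} (ha : 0 ≤ a) :
    expMeasure 1 (Set.Ioi a) = ENNReal.ofReal (Real.exp (-a)) := by
  have := isProbabilityMeasure_expMeasure one_pos
  rw [← Set.compl_Iic, prob_compl_eq_one_sub measurableSet_Iic, expMeasure_Iic ha,
    ← ENNReal.ofReal_one, ← ENNReal.ofReal_sub _ (by
      simp only [sub_nonneg, Real.exp_le_one_iff]; linarith)]
  simp

theorem expMeasure_ofReal_lt {c : ℝ≥0∞} (hc : c ≠ ∞) :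
    expMeasure 1 {e | ENNReal.ofReal e < c} = ENNReal.ofReal (1 - Real.exp (-c.toReal)) := by
  rcases eq_or_ne c 0 with rfl | h0
  · simp
  · rw [← expMeasure_Iio ENNReal.toReal_nonneg]
    congr 1
    ext e
    simp only [Set.mem_ofPred_eq, Set.mem_Iio]
    rw [← ENNReal.ofReal_lt_ofReal_iff (ENNReal.toReal_pos h0 hc), ENNReal.ofReal_toReal hc]

/-- The probability that a clock has not rung by time `t`. -/
noncomputable def survival (rate : ℝ → ℝ≥0) (t : ℝ) : ℝ≥0∞ :=
  ENNReal.ofReal (Real.exp (-(cumulative rate t).toReal))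

theorem measurable_survival (rate : ℝ → ℝ≥0) : Measurable (survival rate) :=
  (Real.measurable_exp.comp (cumulative_mono rate).measurable.ennreal_toReal.neg).ennreal_ofReal

theorem cumulative_le_add {rate : ℝ → ℝ≥0} {κ : ℝ} {C : ℝ≥0}
    (hC : ∀ s ∈ Set.Ioo 0 κ, rate s ≤ C) {s s' : ℝ} (hs : 0 ≤ s) (hss' : s ≤ s') (hs' : s' ≤ κ) :
    cumulative rate s' ≤ cumulative rate s + C * ENNReal.ofReal (s' - s) := by
  unfold cumulative
  rw [← Set.Ioc_union_Ioc_eq_Ioc hs hss',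
    lintegral_union measurableSet_Ioc (Set.Ioc_disjoint_Ioc_of_le le_rfl)]
  gcongr
  rw [setLIntegral_congr Ioo_ae_eq_Ioc.symm]
  calc ∫⁻ u in Set.Ioo s s', (rate u : ℝ≥0∞) ≤ ∫⁻ _ in Set.Ioo s s', (C : ℝ≥0∞) :=
        setLIntegral_mono measurable_const fun u hu => by
          exact_mod_cast hC u ⟨hs.trans_lt hu.1, hu.2.trans_le hs'⟩
    _ = C * ENNReal.ofReal (s' - s) := by simp

theorem cumulative_ne_top {rate : ℝ → ℝ≥0} {κ : ℝ} {C : ℝ≥0}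
    (hC : ∀ s ∈ Set.Ioo 0 κ, rate s ≤ C) {s : ℝ} (hs : s ≤ κ) : cumulative rate s ≠ ∞ := by
  rcases le_total s 0 with h | h
  · simp [cumulative_of_nonpos rate h]
  · refine ne_top_of_le_ne_top ?_ (cumulative_le_add hC le_rfl h hs)
    rw [cumulative_of_nonpos rate le_rfl, zero_add]
    exact ENNReal.mul_ne_top ENNReal.coe_ne_top ENNReal.ofReal_ne_top

theorem expMeasure_clock_lt {rate : ℝ → ℝ≥0} {s : ℝ} (hs : cumulative rate s ≠ ∞) :
    expMeasure 1 {e | clock rate e < ENNReal.ofReal s} =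
      ENNReal.ofReal (1 - Real.exp (-(cumulative rate s).toReal)) := by
  simp only [clock_lt_ofReal_iff]
  exact expMeasure_ofReal_lt hs

theorem expMeasure_le_clock {rate : ℝ → ℝ≥0} {s : ℝ} (hs : cumulative rate s ≠ ∞) :
    expMeasure 1 {e | ENNReal.ofReal s ≤ clock rate e} = survival rate s := by
  have := isProbabilityMeasure_expMeasure one_pos
  have h : {e | ENNReal.ofReal s ≤ clock rate e} = {e | clock rate e < ENNReal.ofReal s}ᶜ := by
    ext e; simp
  rw [h, prob_compl_eq_one_sub (measurableSet_lt (measurable_clock_right rate) measurable_const),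
    expMeasure_clock_lt hs, ← ENNReal.ofReal_one, ← ENNReal.ofReal_sub _ (by simp)]
  simp [survival]

/-- Where the rate is bounded, the integrated rate is also continuous from the right. If e strictly
exceeds its value at s, some later time s' has still not exhausted e, and the clock rings after s.
-/
theorem expMeasure_lt_clock {rate : ℝ → ℝ≥0} {κ : ℝ} {C : ℝ≥0}
    (hC : ∀ s ∈ Set.Ioo 0 κ, rate s ≤ C) {s : ℝ} (hs : 0 ≤ s) (hsκ : s < κ) :
    expMeasure 1 {e | ENNReal.ofReal s < clock rate e} = survival rate s := by
  have hfin := cumulative_ne_top hC hsκ.le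
  refine le_antisymm ?_ ?_
  · rw [← expMeasure_le_clock hfin]
    refine measure_mono fun e he => ?_
    simp only [Set.mem_ofPred_eq] at he ⊢
    exact he.le
  · unfold survival
    rw [← expMeasure_Ioi ENNReal.toReal_nonneg]
    refine measure_mono fun e he => ?_
    have he' : (cumulative rate s).toReal < e := he
    set a := (cumulative rate s).toReal with ha
    obtain ⟨s', h1, h2, h3⟩ : ∃ s', s < s' ∧ s' ≤ κ ∧ C * (s' - s) ≤ e - a := by
      -- The slack e - a pays for the growth of the integrated rate, which is at most C (s' - s).
      -- The denominator C + 1 covers C = 0, and the minimum keeps s' where the rate is bounded.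
      refine ⟨min κ (s + (e - a) / (C + 1)), lt_min hsκ ?_, min_le_left _ _, ?_⟩
      · have : 0 < (e - a) / ((C : ℝ) + 1) := div_pos (sub_pos.2 he') (by positivity)
        linarith
      · have h4 := min_le_right κ (s + (e - a) / ((C : ℝ) + 1))
        calc (C : ℝ) * (min κ (s + (e - a) / (C + 1)) - s) ≤ C * ((e - a) / (C + 1)) := by
              gcongr; linarith
          _ ≤ e - a := by
              rw [mul_div_assoc', div_le_iff₀ (by positivity)]
              nlinarith
    have h4 : ¬ clock rate e < ENNReal.ofReal s' := by
      rw [clock_lt_ofReal_iff, not_lt]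
      refine (cumulative_le_add hC hs h1.le h2).trans ?_
      rw [← ENNReal.ofReal_toReal hfin, ← ENNReal.ofReal_coe_nnreal,
        ← ENNReal.ofReal_mul (by positivity), ← ENNReal.ofReal_add ENNReal.toReal_nonneg
          (mul_nonneg (by positivity) (by linarith))]
      exact ENNReal.ofReal_le_ofReal (by linarith)
    exact lt_of_lt_of_le ((ENNReal.ofReal_lt_ofReal_iff (hs.trans_lt h1)).2 h1) (not_lt.1 h4)

theorem lintegral_rate_mul_survival {rate : ℝ → ℝ≥0} (hrate : Measurable rate) {κ : ℝ} {C : ℝ≥0}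
    (hC : ∀ s ∈ Set.Ioo 0 κ, rate s ≤ C) (hκ : 0 ≤ κ) :
    ∫⁻ s in Set.Ioo 0 κ, rate s * survival rate s =
      ENNReal.ofReal (1 - Real.exp (-(cumulative rate κ).toReal)) := by
  -- The rate is controlled on (0, κ) only; cutting it off elsewhere makes it globally bounded
  -- without changing any integral up to κ.
  set ρ : ℝ → ℝ := (Set.Ioo 0 κ).indicator fun u => (rate u : ℝ) with hρ
  have hm : Measurable ρ := hrate.coe_nnreal_real.indicator measurableSet_Ioo
  have h0 : ∀ x, 0 ≤ ρ x := fun x => Set.indicator_nonneg (fun _ _ => NNReal.coe_nonneg _) x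
  have hb : ∀ x, ρ x ≤ C := fun x =>
    Set.indicator_le' (fun u hu => by exact_mod_cast hC u hu) (fun _ _ => C.2) x
  have hint : ∀ x y, IntervalIntegrable ρ volume x y := fun x y => by
    refine (intervalIntegrable_const (c := (C : ℝ))).mono_fun hm.aestronglyMeasurable ?_
    refine Filter.Eventually.of_forall fun z => ?_
    simp only [Real.norm_eq_abs]
    rw [abs_of_nonneg (h0 z)]
    exact (hb z).trans (le_abs_self _)
  have hcum : ∀ s, 0 ≤ s → s ≤ κ → (cumulative rate s).toReal = ∫ u in (0 : ℝ)..s, ρ u := by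
    intro s hs hsκ
    rw [intervalIntegral.integral_of_le hs, integral_eq_lintegral_of_nonneg_ae
      (Filter.Eventually.of_forall h0) hm.aestronglyMeasurable]
    congr 1
    unfold cumulative
    rw [setLIntegral_congr Ioo_ae_eq_Ioc.symm, setLIntegral_congr (Ioo_ae_eq_Ioc (b := s)).symm]
    refine setLIntegral_congr_fun measurableSet_Ioo fun u hu => ?_
    have : ρ u = rate u := Set.indicator_of_mem (show u ∈ Set.Ioo 0 κ from
      ⟨hu.1, hu.2.trans_le hsκ⟩) _
    simp only [this, ENNReal.ofReal_coe_nnreal]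
  have hI := integral_rate_mul_exp_neg hm h0 hb hκ
  rw [hcum κ hκ le_rfl, ← hI, intervalIntegral.integral_of_le hκ,
    ofReal_integral_eq_lintegral_ofReal]
  · rw [setLIntegral_congr Ioo_ae_eq_Ioc.symm]
    refine setLIntegral_congr_fun measurableSet_Ioo fun u hu => ?_
    have : ρ u = rate u := Set.indicator_of_mem hu _
    simp only [survival, hcum u hu.1.le hu.2.le]
    rw [this, ENNReal.ofReal_mul (by positivity), ENNReal.ofReal_coe_nnreal]
  · refine (intervalIntegrable_iff_integrableOn_Ioc_of_le hκ).1 ?_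
    refine (hint 0 κ).mul_continuousOn ?_
    refine Continuous.continuousOn ?_
    exact Real.continuous_exp.comp (intervalIntegral.continuous_primitive hint 0).neg
  · exact Filter.Eventually.of_forall fun x => mul_nonneg (h0 x) (Real.exp_pos _).le

/-- The law of a clock before a time up to which its rate is bounded. -/
theorem lintegral_clock {rate : ℝ → ℝ≥0} (hrate : Measurable rate) {κ : ℝ} {C : ℝ≥0}
    (hC : ∀ s ∈ Set.Ioo 0 κ, rate s ≤ C) (hκ : 0 ≤ κ) {φ : ℝ → ℝ≥0∞} (hφ : Measurable φ) :
    ∫⁻ e, (if clock rate e < ENNReal.ofReal κ then φ (clock rate e).toReal else 0) ∂expMeasure 1 =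
      ∫⁻ s in Set.Ioo 0 κ, φ s * (rate s * survival rate s) := by
  have := isProbabilityMeasure_expMeasure one_pos
  have hcl : Measurable fun e => (clock rate e).toReal :=
    (measurable_clock_right rate).ennreal_toReal
  have hset : MeasurableSet {e | clock rate e < ENNReal.ofReal κ} :=
    measurableSet_lt (measurable_clock_right rate) measurable_const
  have hdens : Measurable fun s => (rate s : ℝ≥0∞) * survival rate s :=
    hrate.coe_nnreal_ennreal.mul (measurable_survival rate)
  -- The claim is an equality of two finite measures on the line: the law of the clock on the event
  -- that it rings before κ, and the measure with the stated density. They are compared on the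
  -- half-lines (-∞, a), which form a generating π-system.
  set μ₁ := ((expMeasure 1).restrict {e | clock rate e < ENNReal.ofReal κ}).map
    (fun e => (clock rate e).toReal) with hμ₁
  set μ₂ := (volume.restrict (Set.Ioo 0 κ)).withDensity
    (fun s => (rate s : ℝ≥0∞) * survival rate s) with hμ₂
  have hfin : IsFiniteMeasure μ₁ := by rw [hμ₁]; infer_instance
  have hIio : ∀ a, μ₁ (Set.Iio a) = μ₂ (Set.Iio a) := by
    intro a
    rw [hμ₁, hμ₂, Measure.map_apply hcl measurableSet_Iio,
      Measure.restrict_apply (hcl measurableSet_Iio), withDensity_apply _ measurableSet_Iio,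
      Measure.restrict_restrict measurableSet_Iio]
    rcases le_or_gt a 0 with ha | ha
    · have h1 : (fun e => (clock rate e).toReal) ⁻¹' Set.Iio a = ∅ := by
        ext e
        simp only [Set.mem_preimage, Set.mem_Iio, Set.mem_empty_iff_false, iff_false, not_lt]
        exact ha.trans ENNReal.toReal_nonneg
      have h2 : Set.Iio a ∩ Set.Ioo 0 κ = ∅ := by
        ext e
        simp only [Set.mem_inter_iff, Set.mem_Iio, Set.mem_Ioo, Set.mem_empty_iff_false, iff_false]
        rintro ⟨h, h', _⟩
        linarith
      simp [h1, h2]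
    · have h1 : (fun e => (clock rate e).toReal) ⁻¹' Set.Iio a ∩
          {e | clock rate e < ENNReal.ofReal κ} =
          {e | clock rate e < ENNReal.ofReal (min a κ)} := by
        ext e
        simp only [Set.mem_inter_iff, Set.mem_preimage, Set.mem_Iio, Set.mem_ofPred_eq]
        rw [ENNReal.ofReal_min, lt_min_iff]
        refine and_congr_left fun h => ?_
        rw [← ENNReal.ofReal_lt_ofReal_iff ha, ENNReal.ofReal_toReal h.ne_top]
      have h2 : Set.Iio a ∩ Set.Ioo 0 κ = Set.Ioo 0 (min a κ) := by
        ext e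
        simp only [Set.mem_inter_iff, Set.mem_Iio, Set.mem_Ioo, lt_min_iff]
        tauto
      rw [h1, h2, expMeasure_clock_lt (cumulative_ne_top hC (min_le_right _ _)),
        lintegral_rate_mul_survival hrate (fun s hs => hC s ⟨hs.1, hs.2.trans_le (min_le_right _ _)⟩)
          (le_min ha.le hκ)]
  have huniv : μ₁ Set.univ = μ₂ Set.univ := by
    have h1 : (Set.univ : Set ℝ) = ⋃ n : ℕ, Set.Iio (n : ℝ) := by
      ext x; simpa using exists_nat_gt x
    have hmono : Monotone fun n : ℕ => Set.Iio (n : ℝ) := fun m n h =>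
      Set.Iio_subset_Iio (by exact_mod_cast h)
    rw [h1, hmono.measure_iUnion, hmono.measure_iUnion]
    simp only [hIio]
  have heq : μ₁ = μ₂ := by
    refine ext_of_generate_finite _ (borel_eq_generateFrom_Iio ℝ ▸ BorelSpace.measurable_eq)
      isPiSystem_Iio ?_ huniv
    rintro _ ⟨a, rfl⟩
    exact hIio a
  calc _ = ∫⁻ s, φ s ∂μ₁ := by
        rw [hμ₁, lintegral_map hφ hcl, ← lintegral_indicator hset]
        simp only [Set.indicator_apply, Set.mem_ofPred_eq]
    _ = _ := by
        rw [heq, hμ₂, lintegral_withDensity_eq_lintegral_mul _ hdens hφ]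
        simp only [Pi.mul_apply, mul_comm]

/-! ### Finite families of velocities indexed by all natural numbers -/

/-- The `i`-th velocity of a finite family, and `0` if there is none. -/
noncomputable def vel (z : Velocities) (i : ℕ) : Space := if h : i < z.1 then z.2 ⟨i, h⟩ else 0

theorem measurable_of_velocities {β : Type*} [MeasurableSpace β] {f : Velocities → β}
    (h : ∀ n, Measurable fun y : Fin n → Space => f ⟨n, y⟩) : Measurable f := fun _ hs =>
  MeasurableSpace.measurableSet_iInf.2 fun n => h n hs

theorem measurable_velocities_mk (n : ℕ) :
    Measurable fun y : Fin n → Space => (⟨n, y⟩ : Velocities) := fun _ hs =>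
  MeasurableSpace.measurableSet_iInf.1 hs n

theorem measurable_velocities_card : Measurable fun z : Velocities => z.1 :=
  measurable_of_velocities fun _ => measurable_const

theorem measurable_vel (i : ℕ) : Measurable fun z => vel z i := by
  refine measurable_of_velocities fun n => ?_
  by_cases h : i < n
  · simpa [vel, h] using measurable_pi_apply (⟨i, h⟩ : Fin n)
  · simp [vel, h]

/-- With a random number n of offspring the index type `Fin n` varies with the sample. A series over
a fixed index set can be exchanged with integrals term by term. -/
theorem sum_fin_eq_tsum {n : ℕ} {φ : Fin n → ℝ≥0∞} {ψ : ℕ → ℝ≥0∞}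
    (h : ∀ i : Fin n, φ i = ψ i) : ∑ i, φ i = ∑' i, if i < n then ψ i else 0 := by
  rw [tsum_eq_sum (s := Finset.range n) (by
    intro i hi
    rw [if_neg (by simpa using hi)]), Finset.sum_range]
  refine Finset.sum_congr rfl fun i _ => ?_
  rw [if_pos i.2, h]

theorem vel_fin (z : Velocities) (i : Fin z.1) : vel z i = z.2 i := by simp [vel]

/-! ### The life of a single neutron -/

namespace Model

variable (M : Model)

theorem exitTime_lt_ofReal_iff (x : Phase) (s : ℝ) :
    M.exitTime x < ENNReal.ofReal s ↔ ∃ t, 0 < t ∧ t < s ∧ x.1 + t • x.2 ∉ M.D := by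
  unfold exitTime
  simp only [iInf_lt_iff]
  constructor
  · rintro ⟨t, ⟨h1, h2⟩, h⟩
    exact ⟨t, h1, (ENNReal.ofReal_lt_ofReal_iff_of_nonneg h1.le).1 h, h2⟩
  · rintro ⟨t, h1, h, h2⟩
    exact ⟨t, ⟨h1, h2⟩, (ENNReal.ofReal_lt_ofReal_iff_of_nonneg h1.le).2 h⟩

/-- The union over exit times t is uncountable. Because the complement of D is closed, restricting t
to a compact interval inside (0, s) gives the projection of a closed set along a compact factor,
which is closed; countably many such intervals exhaust (0, s). -/
theorem measurable_exitTime : Measurable M.exitTime := by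
  refine measurable_of_lt_ofReal fun s => ?_
  simp only [exitTime_lt_ofReal_iff]
  have h : {x : Phase | ∃ t, 0 < t ∧ t < s ∧ x.1 + t • x.2 ∉ M.D} =
      ⋃ n : ℕ, Prod.snd '' {p : Set.Icc (1 / ((n : ℝ) + 1)) (s - 1 / ((n : ℝ) + 1)) × Phase |
        p.2.1 + (p.1 : ℝ) • p.2.2 ∈ M.Dᶜ} := by
    ext x
    simp only [Set.mem_ofPred_eq, Set.mem_iUnion, Set.mem_image, Prod.exists, Subtype.exists,
      Set.mem_Icc, exists_eq_right, Set.mem_compl_iff]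
    constructor
    · rintro ⟨t, h1, h2, h3⟩
      obtain ⟨n, hn⟩ := exists_nat_one_div_lt (lt_min h1 (sub_pos.2 h2))
      refine ⟨n, t, ⟨(hn.trans_le (min_le_left _ _)).le, ?_⟩, h3⟩
      have := hn.trans_le (min_le_right _ _)
      linarith
    · rintro ⟨n, t, ⟨h1, h2⟩, h3⟩
      have : 0 < 1 / ((n : ℝ) + 1) := by positivity
      exact ⟨t, by linarith, by linarith, h3⟩
  rw [h]
  refine MeasurableSet.iUnion fun n => (isClosedMap_snd_of_compactSpace _ ?_).measurableSet
  refine M.isOpen_D.isClosed_compl.preimage ?_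
  fun_prop

theorem mem_D_of_lt_exitTime {x : Phase} (hx : x.1 ∈ M.D) {s : ℝ} (hs : 0 ≤ s)
    (h : ENNReal.ofReal s < M.exitTime x) : x.1 + s • x.2 ∈ M.D := by
  rcases hs.eq_or_lt with rfl | hs
  · simpa using hx
  · by_contra hD
    exact not_le.2 h (iInf₂_le_of_le s ⟨hs, hD⟩ le_rfl)

theorem exitTime_ne_top {x : Phase} (hx : x ∈ M.domain) : M.exitTime x ≠ ∞ := by
  obtain ⟨R, hR⟩ := M.isBounded_D.exists_norm_le
  have hv : 0 < ‖x.2‖ := M.vmin_pos.trans_le hx.2.1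
  have hR0 : 0 ≤ R := (norm_nonneg _).trans (hR x.1 hx.1)
  -- The speed is at least `vmin` > 0, so by this time the displacement is 2R + 1, more than two
  -- points of the ball of radius R can be apart.
  set t := (2 * R + 1) / ‖x.2‖ with ht
  have ht0 : 0 < t := by positivity
  have htD : x.1 + t • x.2 ∉ M.D := by
    intro h
    have h1 := hR _ h
    have h2 : ‖t • x.2‖ = 2 * R + 1 := by
      rw [norm_smul, Real.norm_of_nonneg ht0.le, ht, div_mul_cancel₀ _ hv.ne']
    have h3 : ‖t • x.2‖ ≤ ‖x.1 + t • x.2‖ + ‖x.1‖ := by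
      simpa using norm_sub_le (x.1 + t • x.2) x.1
    have h4 := hR x.1 hx.1
    linarith
  exact ne_top_of_le_ne_top ENNReal.ofReal_ne_top (iInf₂_le_of_le t ⟨ht0, htD⟩ le_rfl)

theorem measurable_flight :
    Measurable fun p : Phase × ℝ => ((p.1.1 + p.2 • p.1.2, p.1.2) : Phase) := by
  fun_prop

/-- The scatter rate along the flight of a neutron issued from `x`. -/
noncomputable def scatterRate (x : Phase) (s : ℝ) : ℝ≥0 := M.σs (x.1 + s • x.2, x.2)

theorem measurable_scatterRate : Measurable (Function.uncurry M.scatterRate) :=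
  M.measurable_σs.comp measurable_flight

theorem measurable_scatterTime : Measurable fun p : Phase × Noise => M.scatterTime p.1 p.2 := by
  have h' : Measurable fun p : Phase × Noise => (p.1, p.2.1) := by fun_prop
  have h := (measurable_clock M.measurable_scatterRate).comp h'
  exact h

/-- The fission rate along the flight of a neutron issued from `x`. -/
noncomputable def fissionRate (x : Phase) (s : ℝ) : ℝ≥0 := M.σf (x.1 + s • x.2, x.2)

theorem measurable_fissionRate : Measurable (Function.uncurry M.fissionRate) :=
  M.measurable_σf.comp measurable_flight

theorem measurable_fissionTime : Measurable fun p : Phase × Noise => M.fissionTime p.1 p.2 := by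
  have h' : Measurable fun p : Phase × Noise => (p.1, p.2.2.1) := by fun_prop
  have h := (measurable_clock M.measurable_fissionRate).comp h'
  exact h

theorem measurable_lifetime : Measurable fun p : Phase × Noise => M.lifetime p.1 p.2 :=
  (M.measurable_scatterTime.min M.measurable_fissionTime).min
    (M.measurable_exitTime.comp measurable_fst)

theorem measurable_endPoint : Measurable fun p : Phase × Noise => M.endPoint p.1 p.2 := by
  have := M.measurable_lifetime.ennreal_toReal
  unfold endPoint
  fun_prop

theorem measurable_outgoing : Measurable fun p : Phase × Noise => M.outgoing p.1 p.2 := by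
  unfold outgoing
  have hs : ∀ {Y : Type} [Nonempty Y] [MeasurableSpace Y] [StandardBorelSpace Y]
      (κ : Kernel Phase Y) [IsMarkovKernel κ], Measurable fun p : Phase × Noise =>
        sampler κ (M.endPoint p.1 p.2, p.1.2) p.2.2.2 := fun κ _ =>
    (measurable_sampler κ).comp ((M.measurable_endPoint.prodMk
      (measurable_snd.comp measurable_fst)).prodMk
        (measurable_snd.comp (measurable_snd.comp measurable_snd)))
  refine Measurable.ite (measurableSet_le (M.measurable_exitTime.comp measurable_fst)
    (M.measurable_scatterTime.min M.measurable_fissionTime)) measurable_const ?_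
  refine Measurable.ite (measurableSet_lt M.measurable_scatterTime M.measurable_fissionTime) ?_
    (hs _)
  exact (measurable_velocities_mk 1).comp (measurable_pi_lambda _ fun _ => hs _)

/-- The configuration of the `i`-th neutron produced at the end of the life. -/
noncomputable def child (x : Phase) (n : Noise) (i : ℕ) : Phase :=
  (M.endPoint x n, vel (M.outgoing x n) i)

theorem measurable_child (i : ℕ) : Measurable fun p : Phase × Noise => M.child p.1 p.2 i :=
  M.measurable_endPoint.prodMk ((measurable_vel i).comp M.measurable_outgoing)

/-- The number of neutrons produced at the end of the life. -/
noncomputable def card (x : Phase) (n : Noise) : ℕ := (M.outgoing x n).1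

theorem measurable_card : Measurable fun p : Phase × Noise => M.card p.1 p.2 :=
  measurable_velocities_card.comp M.measurable_outgoing

/-- An infinite lifetime counts as an exit, since then ∞ ≤ ∞ selects the empty family. This guards
against the convention that `toReal` sends ∞ to 0, which would otherwise produce successors at the
birth time. -/
theorem card_eq_zero_of_lifetime_eq_top {x : Phase} {n : Noise} (h : M.lifetime x n = ∞) :
    M.card x n = 0 := by
  simp only [lifetime, min_eq_top] at h
  simp [card, outgoing, h]

end Model

/-! ### Independence of the root and of distinct subtrees -/

instance instIsProbabilityMeasureSampleLaw : IsProbabilityMeasure sampleLaw := by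
  unfold sampleLaw; infer_instance

/-- The family of noises in the subtree of the `i`-th neutron that replaces the root. -/
def shift (i : ℕ) (ω : Sample) : Sample := fun w => ω (i :: w)

theorem measurable_shift (i : ℕ) : Measurable (shift i) :=
  measurable_pi_lambda _ fun _ => measurable_pi_apply _

theorem map_shift (i : ℕ) : sampleLaw.map (shift i) = sampleLaw :=
  Measure.map_infinitePi_infinitePi_of_inj (P := fun _ : List ℕ => noiseLaw)
    (f := fun w : List ℕ => i :: w) (List.cons_injective)

theorem map_root : sampleLaw.map (fun ω => ω []) = noiseLaw :=
  Measure.infinitePi_map_eval (fun _ : List ℕ => noiseLaw) []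

theorem iIndep_comap_eval :
    iIndep (fun u : List ℕ => MeasurableSpace.comap (fun ω : Sample => ω u) inferInstance)
      sampleLaw :=
  (iIndepFun_infinitePi (P := fun _ : List ℕ => noiseLaw) (X := fun _ n => n)
    (fun _ => measurable_id)).iIndep

/-- The σ-algebra generated by a block of coordinates is the supremum of those of its coordinates,
and suprema over disjoint blocks of an independent family are independent. -/
theorem indepFun_domRestrict {S T : Set (List ℕ)} (h : Disjoint S T) :
    IndepFun (fun (ω : Sample) (u : S) => ω u) (fun (ω : Sample) (u : T) => ω u) sampleLaw := by
  have hc : ∀ S : Set (List ℕ),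
      MeasurableSpace.comap (fun (ω : Sample) (u : S) => ω u) inferInstance =
        ⨆ u ∈ S, MeasurableSpace.comap (fun ω : Sample => ω u) inferInstance := by
    intro S
    rw [iSup_subtype']
    simp only [MeasurableSpace.pi, MeasurableSpace.comap_iSup, MeasurableSpace.comap_comp]
    rfl
  rw [IndepFun_iff_Indep, hc S, hc T]
  exact indep_iSup_of_disjoint (fun u => (measurable_pi_apply u).comap_le) iIndep_comap_eval h

theorem indepFun_root_shift (i j : ℕ) :
    IndepFun (fun ω : Sample => ω []) (fun ω => (shift i ω, shift j ω)) sampleLaw := by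
  have h : Disjoint ({[]} : Set (List ℕ)) {u | u ≠ []} := by
    simp
  have hψ : Measurable fun y : {u : List ℕ | u ≠ []} → Noise =>
      ((fun w => y ⟨i :: w, List.cons_ne_nil _ _⟩ : Sample),
        (fun w => y ⟨j :: w, List.cons_ne_nil _ _⟩ : Sample)) :=
    (measurable_pi_lambda _ fun w => measurable_pi_apply _).prodMk
      (measurable_pi_lambda _ fun w => measurable_pi_apply _)
  exact (indepFun_domRestrict h).comp
    (measurable_pi_apply (⟨[], rfl⟩ : ({[]} : Set (List ℕ)))) hψ

theorem indepFun_shift_shift {i j : ℕ} (hij : i ≠ j) :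
    IndepFun (shift i) (shift j) sampleLaw := by
  have h : Disjoint (Set.range (List.cons i)) (Set.range (List.cons j)) := by
    rw [Set.disjoint_left]
    rintro _ ⟨u, rfl⟩ ⟨v, hv⟩
    exact hij (List.cons.inj hv).1.symm
  exact (indepFun_domRestrict h).comp
    (φ := fun y => (fun w => y ⟨i :: w, w, rfl⟩ : Sample))
    (ψ := fun y => (fun w => y ⟨j :: w, w, rfl⟩ : Sample))
    (measurable_pi_lambda _ fun _ => measurable_pi_apply _)
    (measurable_pi_lambda _ fun _ => measurable_pi_apply _)

theorem map_root_shift_shift {i j : ℕ} (hij : i ≠ j) :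
    sampleLaw.map (fun ω => (ω [], shift i ω, shift j ω)) =
      noiseLaw.prod (sampleLaw.prod sampleLaw) := by
  have h2 : Measurable fun ω => (shift i ω, shift j ω) :=
    (measurable_shift i).prodMk (measurable_shift j)
  rw [(indepFun_iff_map_prod_eq_prod_map_map (measurable_pi_apply _).aemeasurable
    h2.aemeasurable).1 (indepFun_root_shift i j),
    (indepFun_iff_map_prod_eq_prod_map_map (measurable_shift i).aemeasurable
    (measurable_shift j).aemeasurable).1 (indepFun_shift_shift hij), map_shift, map_shift, map_root]

/-- Distinct subtrees and the root are independent. -/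
theorem lintegral_root_shift_shift {i j : ℕ} (hij : i ≠ j) {φ : Noise × Sample × Sample → ℝ≥0∞}
    (hφ : Measurable φ) :
    ∫⁻ ω, φ (ω [], shift i ω, shift j ω) ∂sampleLaw =
      ∫⁻ n, ∫⁻ ω, ∫⁻ ω', φ (n, ω, ω') ∂sampleLaw ∂sampleLaw ∂noiseLaw := by
  have hm : Measurable fun ω : Sample => (ω [], shift i ω, shift j ω) :=
    (measurable_pi_apply _).prodMk ((measurable_shift i).prodMk (measurable_shift j))
  rw [← lintegral_map hφ hm, map_root_shift_shift hij, lintegral_prod _ hφ.aemeasurable]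
  refine lintegral_congr fun n => ?_
  exact lintegral_prod (fun p => φ (n, p)) (hφ.comp measurable_prodMk_left).aemeasurable

theorem lintegral_root_shift (i : ℕ) {φ : Noise × Sample → ℝ≥0∞} (hφ : Measurable φ) :
    ∫⁻ ω, φ (ω [], shift i ω) ∂sampleLaw = ∫⁻ n, ∫⁻ ω, φ (n, ω) ∂sampleLaw ∂noiseLaw := by
  have hm : Measurable fun p : Noise × Sample × Sample => (p.1, p.2.1) := by fun_prop
  -- The subtree of index i + 1 serves as a dummy, over which a constant is integrated against a
  -- probability.
  have := lintegral_root_shift_shift (Nat.succ_ne_self i).symm (hφ.comp hm)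
  simpa using this

theorem lintegral_root {φ : Noise → ℝ≥0∞} (hφ : Measurable φ) :
    ∫⁻ ω : Sample, φ (ω []) ∂sampleLaw = ∫⁻ n, φ n ∂noiseLaw := by
  rw [← map_root, lintegral_map hφ (measurable_pi_apply _)]

theorem tsum_list (a : List ℕ → ℝ≥0∞) : ∑' u, a u = a [] + ∑' i, ∑' u, a (i :: u) := by
  let e : List ℕ ≃ Unit ⊕ (ℕ × List ℕ) :=
    { toFun := fun u => match u with
        | [] => Sum.inl ()
        | i :: u => Sum.inr (i, u)
      invFun := Sum.elim (fun _ => []) fun p => p.1 :: p.2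
      left_inv := by rintro (_ | _) <;> rfl
      right_inv := by rintro (_ | _) <;> rfl }
  rw [← e.symm.tsum_eq, Summable.tsum_sum ENNReal.summable ENNReal.summable, ENNReal.tsum_prod']
  simp [e]

/-! ### The process as a sum over labels, truncated by generation -/

namespace Model

variable (M : Model)

open Classical in
/-- The contribution to `⟨h, X_t⟩` of the neutron with label `u`. -/
noncomputable def contrib (h : Phase → ℝ≥0∞) : List ℕ → ℝ → Phase → Sample → ℝ≥0∞
  | [], t, x, ω =>
    if 0 ≤ t ∧ ENNReal.ofReal t < M.lifetime x (ω []) then h (x.1 + t • x.2, x.2) else 0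
  | i :: u, t, x, ω =>
    if i < M.card x (ω []) then
      contrib h u (t - (M.lifetime x (ω [])).toReal) (M.child x (ω []) i) (shift i ω)
    else 0

open Classical in
-- `neutron` carries the date of birth down the tree, `contrib` the time that is left. Only the
-- difference t - b matters, so the two descriptions agree.
theorem contrib_eq (h : Phase → ℝ≥0∞) (u : List ℕ) (b t : ℝ) (x : Phase) (ω : Sample) :
    M.contrib h u (t - b) x ω = match M.neutron u b x ω with
      | none => 0
      | some (c, y) =>
        if c ≤ t ∧ ENNReal.ofReal (t - c) < M.lifetime y (ω u) then
          h (y.1 + (t - c) • y.2, y.2) else 0 := by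
  induction u generalizing b x ω with
  | nil => simp [contrib, neutron]
  | cons i u ih =>
    unfold contrib neutron
    by_cases hi : i < (M.outgoing x (ω [])).1
    · rw [if_pos (show i < M.card x (ω []) from hi), dif_pos hi, sub_sub, ih]
      simp only [child, vel, hi, dite_true]
      rfl
    · rw [if_neg (show ¬ i < M.card x (ω []) from hi), dif_neg hi]

theorem lintegral_X (h : Phase → ℝ≥0∞) (t : ℝ) (x : Phase) (ω : Sample) :
    ∫⁻ y, h y ∂(M.X t x ω) = ∑' u, M.contrib h u t x ω := by
  unfold X
  rw [lintegral_sum_measure]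
  refine tsum_congr fun u => ?_
  have := M.contrib_eq h u 0 t x ω
  rw [sub_zero] at this
  rw [this]
  cases M.neutron u 0 x ω with
  | none => simp
  | some p =>
    simp only
    split_ifs <;> simp

/-- The parameter space P is there because Duhamel's integrand applies the process at time s to the
test function H(t - s, ·), which itself moves with s. -/
theorem measurable_contrib {P : Type*} [MeasurableSpace P] {H : P × Phase → ℝ≥0∞}
    (hH : Measurable H) (u : List ℕ) :
    Measurable fun q : P × ℝ × Phase × Sample =>
      M.contrib (fun y => H (q.1, y)) u q.2.1 q.2.2.1 q.2.2.2 := by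
  induction u with
  | nil =>
    simp only [contrib]
    have hx : Measurable fun q : P × ℝ × Phase × Sample => (q.2.2.1, q.2.2.2 []) := by fun_prop
    have hl := M.measurable_lifetime.comp hx
    have hp : Measurable fun q : P × ℝ × Phase × Sample =>
        (q.1, ((q.2.2.1.1 + q.2.1 • q.2.2.1.2, q.2.2.1.2) : Phase)) := by fun_prop
    refine Measurable.ite ?_ (hH.comp hp) measurable_const
    have ht : Measurable fun q : P × ℝ × Phase × Sample => q.2.1 := by fun_prop
    refine MeasurableSet.inter (measurableSet_le measurable_const ht) ?_
    exact measurableSet_lt ht.ennreal_ofReal hl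
  | cons i u ih =>
    simp only [contrib]
    have hx : Measurable fun q : P × ℝ × Phase × Sample => (q.2.2.1, q.2.2.2 []) := by fun_prop
    have hl := (M.measurable_lifetime.comp hx).ennreal_toReal
    have hc := (M.measurable_child i).comp hx
    have hn := M.measurable_card.comp hx
    have hs : Measurable fun q : P × ℝ × Phase × Sample => shift i q.2.2.2 :=
      (measurable_shift i).comp (by fun_prop)
    have ht : Measurable fun q : P × ℝ × Phase × Sample =>
        q.2.1 - (M.lifetime q.2.2.1 (q.2.2.2 [])).toReal :=
      Measurable.sub (by fun_prop) hl
    refine Measurable.ite (measurableSet_lt measurable_const hn) ?_ measurable_const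
    exact ih.comp (measurable_fst.prodMk (ht.prodMk (hc.prodMk hs)))

/-- The time left can only decrease down the tree. This vanishing allows time integrals to be taken
over the whole line. -/
theorem contrib_of_neg {h : Phase → ℝ≥0∞} {u : List ℕ} {t : ℝ} (ht : t < 0) {x : Phase}
    {ω : Sample} : M.contrib h u t x ω = 0 := by
  induction u generalizing t x ω with
  | nil => simp [contrib, not_le.2 ht]
  | cons i u ih =>
    simp only [contrib]
    rw [ih (by linarith [ENNReal.toReal_nonneg (a := M.lifetime x (ω []))]), ite_self]

open Classical in
/-- The part of `⟨h, X_t⟩` due to neutrons of generation less than `n`. -/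
noncomputable def W (n : ℕ∞) (h : Phase → ℝ≥0∞) (t : ℝ) (x : Phase) (ω : Sample) : ℝ≥0∞ :=
  ∑' u : List ℕ, if (u.length : ℕ∞) < n then M.contrib h u t x ω else 0

theorem W_zero (h : Phase → ℝ≥0∞) (t : ℝ) (x : Phase) (ω : Sample) : M.W 0 h t x ω = 0 := by
  simp [W]

theorem W_top (h : Phase → ℝ≥0∞) (t : ℝ) (x : Phase) (ω : Sample) :
    M.W ⊤ h t x ω = ∫⁻ y, h y ∂(M.X t x ω) := by
  rw [lintegral_X]
  simp [W]

theorem W_of_neg {n : ℕ∞} {h : Phase → ℝ≥0∞} {t : ℝ} (ht : t < 0) {x : Phase} {ω : Sample} :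
    M.W n h t x ω = 0 := by
  simp [W, M.contrib_of_neg ht]

theorem measurable_W {P : Type*} [MeasurableSpace P] {H : P × Phase → ℝ≥0∞}
    (hH : Measurable H) (n : ℕ∞) :
    Measurable fun q : P × ℝ × Phase × Sample =>
      M.W n (fun y => H (q.1, y)) q.2.1 q.2.2.1 q.2.2.2 := by
  unfold W
  refine Measurable.tsum fun u => ?_
  split_ifs
  · exact M.measurable_contrib hH u
  · exact measurable_const

theorem W_mono (h : Phase → ℝ≥0∞) (t : ℝ) (x : Phase) (ω : Sample) :
    Monotone fun n => M.W n h t x ω := by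
  intro m n hmn
  refine ENNReal.tsum_le_tsum fun u => ?_
  split_ifs with h1 h2
  · exact le_rfl
  · exact absurd (h1.trans_le hmn) h2
  · exact zero_le
  · exact le_rfl

/-- A finite set of labels lies in boundedly many generations, and a series in [0,∞] is the supremum
of its finite partial sums. -/
theorem iSup_W (h : Phase → ℝ≥0∞) (t : ℝ) (x : Phase) (ω : Sample) :
    ⨆ n : ℕ, M.W n h t x ω = M.W ⊤ h t x ω := by
  refine le_antisymm (iSup_le fun n => M.W_mono h t x ω le_top) ?_
  conv_lhs => unfold W
  rw [ENNReal.tsum_eq_iSup_sum]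
  refine iSup_le fun s => ?_
  refine le_iSup_of_le (s.sup List.length + 1) ?_
  refine le_trans (Finset.sum_le_sum fun u hu => ?_) (ENNReal.sum_le_tsum s)
  have : (u.length : ℕ∞) < ((s.sup List.length + 1 : ℕ) : ℕ∞) := by
    exact_mod_cast Nat.lt_succ_of_le (Finset.le_sup (f := List.length) hu)
  rw [if_pos this]
  split_ifs <;> simp

open Classical in
/-- The contribution of the initial neutron. -/
noncomputable def first (h : Phase → ℝ≥0∞) (t : ℝ) (x : Phase) (n : Noise) : ℝ≥0∞ :=
  if 0 ≤ t ∧ ENNReal.ofReal t < M.lifetime x n then h (x.1 + t • x.2, x.2) else 0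

open Classical in
/-- The decomposition at the end of the life of the initial neutron. -/
theorem W_succ (n : ℕ∞) (h : Phase → ℝ≥0∞) (t : ℝ) (x : Phase) (ω : Sample) :
    M.W (n + 1) h t x ω = M.first h t x (ω []) + ∑' i, if i < M.card x (ω []) then
      M.W n h (t - (M.lifetime x (ω [])).toReal) (M.child x (ω []) i) (shift i ω) else 0 := by
  conv_lhs => unfold W
  rw [tsum_list]
  congr 1
  · rw [if_pos (by simp)]
    rfl
  · refine tsum_congr fun i => ?_
    have h1 : ∀ u : List ℕ, (((i :: u).length : ℕ∞) < n + 1) = ((u.length : ℕ∞) < n) := by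
      intro u
      rw [List.length_cons, Nat.cast_add, Nat.cast_one]
      exact propext (ENat.add_lt_add_iff_right ENat.one_ne_top)
    simp only [h1, contrib]
    split_ifs with hi
    · rfl
    · simp

end Model

/-! ### Recursions for the first and second moments -/

theorem tsum_mul_tsum_eq_diag_add (b c : ℕ → ℝ≥0∞) :
    (∑' i, b i) * ∑' j, c j = ∑' i, b i * c i + ∑' i, ∑' j, if i ≠ j then b i * c j else 0 := by
  rw [← ENNReal.tsum_add, ← ENNReal.tsum_mul_right]
  refine tsum_congr fun i => ?_
  rw [← ENNReal.tsum_mul_left, ENNReal.tsum_eq_add_tsum_ite i]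
  congr 1
  refine tsum_congr fun j => ?_
  by_cases h : j = i
  · simp [h]
  · simp [h, Ne.symm h]

theorem lintegral_ite_const {α : Type*} [MeasurableSpace α] {μ : Measure α} (p : Prop) [Decidable p]
    (f : α → ℝ≥0∞) : ∫⁻ a, (if p then f a else 0) ∂μ = if p then ∫⁻ a, f a ∂μ else 0 := by
  split_ifs <;> simp

namespace Model

variable (M : Model)

theorem measurable_W_of_measurable {h : Phase → ℝ≥0∞} (hh : Measurable h) (n : ℕ∞) :
    Measurable fun q : ℝ × Phase × Sample => M.W n h q.1 q.2.1 q.2.2 :=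
  (M.measurable_W (P := Unit) (hh.comp measurable_snd) n).comp
    (measurable_const (a := ()) |>.prodMk measurable_id)

/-- The mean of `⟨h, X_t⟩` restricted to generations less than `n`. -/
noncomputable def mean (n : ℕ∞) (h : Phase → ℝ≥0∞) (t : ℝ) (x : Phase) : ℝ≥0∞ :=
  ∫⁻ ω, M.W n h t x ω ∂sampleLaw

theorem mean_top (h : Phase → ℝ≥0∞) (t : ℝ) (x : Phase) : M.mean ⊤ h t x = M.ψ t h x := by
  simp only [mean, W_top, ψ]

theorem mean_zero (h : Phase → ℝ≥0∞) (t : ℝ) (x : Phase) : M.mean 0 h t x = 0 := by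
  simp [mean, W_zero]

theorem mean_of_neg {n : ℕ∞} {h : Phase → ℝ≥0∞} {t : ℝ} (ht : t < 0) {x : Phase} :
    M.mean n h t x = 0 := by
  simp [mean, M.W_of_neg ht]

theorem mean_mono (h : Phase → ℝ≥0∞) (t : ℝ) (x : Phase) : Monotone fun n => M.mean n h t x :=
  fun _ _ hmn => lintegral_mono fun ω => M.W_mono h t x ω hmn

theorem measurable_mean {P : Type*} [MeasurableSpace P] {H : P × Phase → ℝ≥0∞}
    (hH : Measurable H) (n : ℕ∞) :
    Measurable fun q : P × ℝ × Phase => M.mean n (fun y => H (q.1, y)) q.2.1 q.2.2 := by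
  have hm : Measurable fun r : (P × ℝ × Phase) × Sample => (r.1.1, r.1.2.1, r.1.2.2, r.2) := by
    fun_prop
  exact ((M.measurable_W hH n).comp hm).lintegral_prod_right'

theorem measurable_mean_of_measurable {h : Phase → ℝ≥0∞} (hh : Measurable h) (n : ℕ∞) :
    Measurable fun q : ℝ × Phase => M.mean n h q.1 q.2 :=
  (M.measurable_mean (P := Unit) (hh.comp measurable_snd) n).comp
    (measurable_const (a := ()) |>.prodMk measurable_id)

theorem iSup_mean {h : Phase → ℝ≥0∞} (hh : Measurable h) (t : ℝ) (x : Phase) :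
    ⨆ n : ℕ, M.mean n h t x = M.mean ⊤ h t x := by
  unfold mean
  rw [← lintegral_iSup]
  · simp only [iSup_W]
  · intro n
    exact (M.measurable_W_of_measurable hh n).comp
      (measurable_const.prodMk (measurable_const.prodMk measurable_id))
  · intro m n hmn ω
    exact M.W_mono h t x ω (by exact_mod_cast hmn)

/-- The second moment of the process restricted to generations less than `n`. -/
noncomputable def second (n : ℕ∞) (f g : Phase → ℝ≥0∞) (t : ℝ) (x : Phase) : ℝ≥0∞ :=
  ∫⁻ ω, M.W n f t x ω * M.W n g t x ω ∂sampleLaw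

theorem second_zero (f g : Phase → ℝ≥0∞) (t : ℝ) (x : Phase) : M.second 0 f g t x = 0 := by
  simp [second, W_zero]

theorem iSup_second {f g : Phase → ℝ≥0∞} (hf : Measurable f) (hg : Measurable g)
    (t : ℝ) (x : Phase) : ⨆ n : ℕ, M.second n f g t x = M.second ⊤ f g t x := by
  have hmono : ∀ (h : Phase → ℝ≥0∞) (ω : Sample), Monotone fun n : ℕ => M.W n h t x ω :=
    fun h ω m n hmn => M.W_mono h t x ω (by exact_mod_cast hmn)
  unfold second
  rw [← lintegral_iSup]
  · refine lintegral_congr fun ω => ?_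
    rw [← iSup_W, ← iSup_W, ENNReal.iSup_mul]
    simp only [ENNReal.mul_iSup]
    refine le_antisymm (iSup_le fun n => le_iSup_of_le n (le_iSup_of_le n le_rfl))
      (iSup_le fun m => iSup_le fun n => le_iSup_of_le (max m n) ?_)
    exact mul_le_mul' (hmono f ω (le_max_left _ _)) (hmono g ω (le_max_right _ _))
  · intro n
    have hm : Measurable fun ω : Sample => (t, x, ω) :=
      measurable_const.prodMk (measurable_const.prodMk measurable_id)
    exact ((M.measurable_W_of_measurable hf n).comp hm).mul
      ((M.measurable_W_of_measurable hg n).comp hm)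
  · intro m n hmn ω
    exact mul_le_mul' (hmono f ω hmn) (hmono g ω hmn)

theorem measurable_lifetime_right (x : Phase) : Measurable fun n => M.lifetime x n := by
  have h := M.measurable_lifetime.comp (measurable_prodMk_left (x := x) (β := Noise))
  exact h

theorem measurable_child_right (x : Phase) (i : ℕ) : Measurable fun n => M.child x n i := by
  have h := (M.measurable_child i).comp (measurable_prodMk_left (x := x) (β := Noise))
  exact h

theorem measurable_card_right (x : Phase) : Measurable fun n => M.card x n := by
  have h := M.measurable_card.comp (measurable_prodMk_left (x := x) (β := Noise))
  exact h

/-- The residual time and the configuration of the `i`-th neutron that replaces the initial one. -/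
noncomputable def residual (t : ℝ) (x : Phase) (i : ℕ) (n : Noise) : ℝ × Phase :=
  (t - (M.lifetime x n).toReal, M.child x n i)

theorem measurable_residual (t : ℝ) (x : Phase) (i : ℕ) : Measurable (M.residual t x i) :=
  (measurable_const.sub (M.measurable_lifetime_right x).ennreal_toReal).prodMk
    (M.measurable_child_right x i)

theorem measurable_residual_prodMk {α : Type*} [MeasurableSpace α] {a : α → Noise} {b : α → Sample}
    (ha : Measurable a) (hb : Measurable b) (t : ℝ) (x : Phase) (i : ℕ) :
    Measurable fun p => (t - (M.lifetime x (a p)).toReal, M.child x (a p) i, b p) := by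
  have h := (M.measurable_residual t x i).comp ha
  exact (measurable_fst.comp h).prodMk ((measurable_snd.comp h).prodMk hb)

theorem measurableSet_lt_card (x : Phase) (i : ℕ) : MeasurableSet {n | i < M.card x n} :=
  measurableSet_lt measurable_const (M.measurable_card_right x)

theorem measurable_first {h : Phase → ℝ≥0∞} (t : ℝ) (x : Phase) :
    Measurable (M.first h t x) := by
  unfold first
  exact Measurable.ite ((MeasurableSet.const _).inter (measurableSet_lt measurable_const
    (M.measurable_lifetime_right x))) measurable_const
      measurable_const

/-- The contribution of the initial neutron to the mean. -/
noncomputable def firstMean (h : Phase → ℝ≥0∞) (t : ℝ) (x : Phase) : ℝ≥0∞ :=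
  ∫⁻ n, M.first h t x n ∂noiseLaw

/-- The contribution of the neutrons that replace the initial one, if a neutron with configuration
`y` and residual time `s` contributes `Ψ s y`. -/
noncomputable def branch (Ψ : ℝ → Phase → ℝ≥0∞) (t : ℝ) (x : Phase) : ℝ≥0∞ :=
  ∫⁻ n, ∑' i, (if i < M.card x n then Ψ (t - (M.lifetime x n).toReal) (M.child x n i) else 0)
    ∂noiseLaw

/-- The contribution of the pairs of distinct neutrons that replace the initial one. -/
noncomputable def pairs (Φ Ψ : ℝ → Phase → ℝ≥0∞) (t : ℝ) (x : Phase) : ℝ≥0∞ :=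
  ∫⁻ n, ∑' i, ∑' j, (if i ≠ j ∧ i < M.card x n ∧ j < M.card x n then
    Φ (t - (M.lifetime x n).toReal) (M.child x n i) *
      Ψ (t - (M.lifetime x n).toReal) (M.child x n j) else 0) ∂noiseLaw

theorem measurable_branch_term {Ψ : ℝ → Phase → ℝ≥0∞} (hΨ : Measurable (Function.uncurry Ψ))
    (t : ℝ) (x : Phase) (i : ℕ) : Measurable fun n =>
      if i < M.card x n then Ψ (t - (M.lifetime x n).toReal) (M.child x n i) else 0 :=
  Measurable.ite (M.measurableSet_lt_card x i) (hΨ.comp (M.measurable_residual t x i))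
    measurable_const

theorem branch_add {Φ Ψ : ℝ → Phase → ℝ≥0∞} (hΦ : Measurable (Function.uncurry Φ))
    (t : ℝ) (x : Phase) :
    M.branch (fun s y => Φ s y + Ψ s y) t x = M.branch Φ t x + M.branch Ψ t x := by
  unfold branch
  rw [← lintegral_add_left (Measurable.tsum fun i => M.measurable_branch_term hΦ t x i)]
  refine lintegral_congr fun n => ?_
  rw [← ENNReal.tsum_add]
  refine tsum_congr fun i => ?_
  split_ifs <;> simp

/-- The branching property in mean: given the noise of the root, each subtree carries a fresh copy
of the sample space, which can be integrated out first. -/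
theorem lintegral_subtree {Φ : ℝ × Phase × Sample → ℝ≥0∞} (hΦ : Measurable Φ) (t : ℝ) (x : Phase) :
    ∫⁻ ω, ∑' i, (if i < M.card x (ω []) then
      Φ (t - (M.lifetime x (ω [])).toReal, M.child x (ω []) i, shift i ω) else 0) ∂sampleLaw =
    M.branch (fun s y => ∫⁻ ω, Φ (s, y, ω) ∂sampleLaw) t x := by
  have hm : ∀ i, Measurable fun p : Noise × Sample => if i < M.card x p.1 then
      Φ (t - (M.lifetime x p.1).toReal, M.child x p.1 i, p.2) else 0 := by
    intro i
    have h2 := M.measurable_residual_prodMk (measurable_fst (α := Noise) (β := Sample))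
      measurable_snd t x i
    have h3 := hΦ.comp h2
    exact Measurable.ite (measurable_fst (M.measurableSet_lt_card x i)) h3 measurable_const
  have hr : ∀ i, Measurable fun ω : Sample => (ω [], shift i ω) := fun i =>
    (measurable_pi_apply _).prodMk (measurable_shift i)
  have hmr : ∀ i, Measurable fun ω : Sample => if i < M.card x (ω []) then
      Φ (t - (M.lifetime x (ω [])).toReal, M.child x (ω []) i, shift i ω) else 0 := by
    intro i
    have h := (hm i).comp (hr i)
    exact h
  unfold branch
  rw [lintegral_tsum fun i => (hmr i).aemeasurable, lintegral_tsum]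
  · refine tsum_congr fun i => (lintegral_root_shift i (hm i)).trans ?_
    refine lintegral_congr fun n => ?_
    exact lintegral_ite_const (i < M.card x n) _
  · intro i
    refine (M.measurable_branch_term (Ψ := fun s y => ∫⁻ ω, Φ (s, y, ω) ∂sampleLaw) ?_
      t x i).aemeasurable
    have hm : Measurable fun r : (ℝ × Phase) × Sample => (r.1.1, r.1.2, r.2) := by fun_prop
    exact (hΦ.comp hm).lintegral_prod_right'

theorem mean_succ {h : Phase → ℝ≥0∞} (hh : Measurable h) (n : ℕ∞) (t : ℝ) (x : Phase) :
    M.mean (n + 1) h t x = M.firstMean h t x + M.branch (M.mean n h) t x := by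
  conv_lhs => unfold mean
  have hfirst : Measurable fun ω : Sample => M.first h t x (ω []) :=
    (M.measurable_first t x).comp (measurable_pi_apply _)
  simp only [W_succ]
  rw [lintegral_add_left hfirst, lintegral_root (M.measurable_first t x)]
  congr 1
  exact M.lintegral_subtree (M.measurable_W_of_measurable hh n) t x

theorem first_mul_first (f g : Phase → ℝ≥0∞) (t : ℝ) (x : Phase) (n : Noise) :
    M.first f t x n * M.first g t x n = M.first (fun y => f y * g y) t x n := by
  unfold first
  split_ifs <;> simp

/-- If the initial neutron is alive at t, its successors have a negative residual time and
contribute nothing. -/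
theorem first_mul_eq_zero (f h : Phase → ℝ≥0∞) (t : ℝ) (x : Phase) (m : ℕ∞) (n : Noise)
    (ω : ℕ → Sample) :
    M.first f t x n * ∑' i, (if i < M.card x n then
      M.W m h (t - (M.lifetime x n).toReal) (M.child x n i) (ω i) else 0) = 0 := by
  unfold first
  split_ifs with hc
  · refine mul_eq_zero_of_right _ (ENNReal.tsum_eq_zero.2 fun i => ?_)
    split_ifs with hi
    · have hT : M.lifetime x n ≠ ∞ := fun hT => by
        rw [M.card_eq_zero_of_lifetime_eq_top hT] at hi
        exact absurd hi (Nat.not_lt_zero i)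
      refine M.W_of_neg ?_
      have := (ENNReal.ofReal_lt_iff_lt_toReal hc.1 hT).1 hc.2
      linarith
    · rfl
  · simp

/-- Only three products survive: the initial neutron with itself, each subtree with itself, and
distinct subtrees with each other. The last part contains the means truncated at n, so this is not
yet the recursion of the many-to-two formula unless n = ⊤. -/
theorem second_succ {f g : Phase → ℝ≥0∞} (hf : Measurable f) (hg : Measurable g) (n : ℕ∞)
    (t : ℝ) (x : Phase) :
    M.second (n + 1) f g t x = M.firstMean (fun y => f y * g y) t x +
      M.branch (M.second n f g) t x + M.pairs (M.mean n f) (M.mean n g) t x := by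
  have hWf := M.measurable_W_of_measurable hf n
  have hWg := M.measurable_W_of_measurable hg n
  have hroot : Measurable fun ω : Sample => ω [] := measurable_pi_apply _
  have hpt : ∀ ω : Sample, M.W (n + 1) f t x ω * M.W (n + 1) g t x ω =
      M.first (fun y => f y * g y) t x (ω []) +
      (∑' i, (if i < M.card x (ω []) then
        M.W n f (t - (M.lifetime x (ω [])).toReal) (M.child x (ω []) i) (shift i ω) *
        M.W n g (t - (M.lifetime x (ω [])).toReal) (M.child x (ω []) i) (shift i ω) else 0) +
      ∑' i, ∑' j, (if i ≠ j ∧ i < M.card x (ω []) ∧ j < M.card x (ω []) then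
        M.W n f (t - (M.lifetime x (ω [])).toReal) (M.child x (ω []) i) (shift i ω) *
        M.W n g (t - (M.lifetime x (ω [])).toReal) (M.child x (ω []) j) (shift j ω) else 0)) := by
    intro ω
    rw [W_succ, W_succ, add_mul, mul_add, first_mul_first, M.first_mul_eq_zero f g t x n (ω [])
      (fun i => shift i ω), add_zero, mul_add, mul_comm _ (M.first g t x (ω [])),
      M.first_mul_eq_zero g f t x n (ω []) (fun i => shift i ω), zero_add,
      tsum_mul_tsum_eq_diag_add]
    congr 2
    · refine tsum_congr fun i => ?_
      split_ifs <;> simp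
    · refine tsum_congr fun i => tsum_congr fun j => ?_
      by_cases h1 : i < M.card x (ω []) <;> by_cases h2 : j < M.card x (ω []) <;>
        simp [h1, h2]
  conv_lhs => unfold second
  simp only [hpt]
  have hfirst : Measurable fun ω : Sample => M.first (fun y => f y * g y) t x (ω []) :=
    (M.measurable_first t x).comp hroot
  have hdiag : Measurable fun ω : Sample => ∑' i, (if i < M.card x (ω []) then
        M.W n f (t - (M.lifetime x (ω [])).toReal) (M.child x (ω []) i) (shift i ω) *
        M.W n g (t - (M.lifetime x (ω [])).toReal) (M.child x (ω []) i) (shift i ω) else 0) := by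
    refine Measurable.tsum fun i => Measurable.ite (hroot (M.measurableSet_lt_card x i)) ?_
      measurable_const
    have h := M.measurable_residual_prodMk hroot (measurable_shift i) t x i
    have h1 := hWf.comp h
    have h2 := hWg.comp h
    exact h1.mul h2
  rw [lintegral_add_left hfirst, lintegral_root (M.measurable_first t x),
    lintegral_add_left hdiag, ← add_assoc]
  congr 1
  · congr 1
    have hWW : Measurable fun q : ℝ × Phase × Sample =>
        M.W n f q.1 q.2.1 q.2.2 * M.W n g q.1 q.2.1 q.2.2 := hWf.mul hWg
    have h := M.lintegral_subtree hWW t x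
    exact h
  · unfold pairs
    have hmeas : ∀ i j, Measurable fun p : Noise × Sample × Sample =>
        if i ≠ j ∧ i < M.card x p.1 ∧ j < M.card x p.1 then
        M.W n f (t - (M.lifetime x p.1).toReal) (M.child x p.1 i) p.2.1 *
        M.W n g (t - (M.lifetime x p.1).toReal) (M.child x p.1 j) p.2.2 else 0 := by
      intro i j
      have h3 : Measurable fun p : Noise × Sample × Sample => p.2.1 := by fun_prop
      have h4 : Measurable fun p : Noise × Sample × Sample => p.2.2 := by fun_prop
      have h1 := M.measurable_residual_prodMk measurable_fst h3 t x i
      have h2 := M.measurable_residual_prodMk measurable_fst h4 t x j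
      have h5 := hWf.comp h1
      have h6 := hWg.comp h2
      exact Measurable.ite ((MeasurableSet.const _).inter
        ((measurable_fst (M.measurableSet_lt_card x i)).inter
          (measurable_fst (M.measurableSet_lt_card x j)))) (h5.mul h6) measurable_const
    have hr : ∀ i j, Measurable fun ω : Sample => (ω [], shift i ω, shift j ω) := fun i j =>
      hroot.prodMk ((measurable_shift i).prodMk (measurable_shift j))
    have hmeas' : ∀ i j, Measurable fun m : Noise =>
        if i ≠ j ∧ i < M.card x m ∧ j < M.card x m then
        M.mean n f (t - (M.lifetime x m).toReal) (M.child x m i) *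
        M.mean n g (t - (M.lifetime x m).toReal) (M.child x m j) else 0 := fun i j =>
      Measurable.ite ((MeasurableSet.const _).inter
        ((M.measurableSet_lt_card x i).inter (M.measurableSet_lt_card x j)))
        (((M.measurable_mean_of_measurable hf n).comp (M.measurable_residual t x i)).mul
          ((M.measurable_mean_of_measurable hg n).comp (M.measurable_residual t x j)))
        measurable_const
    have hmeasr : ∀ i j, Measurable fun ω : Sample =>
        if i ≠ j ∧ i < M.card x (ω []) ∧ j < M.card x (ω []) then
        M.W n f (t - (M.lifetime x (ω [])).toReal) (M.child x (ω []) i) (shift i ω) *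
        M.W n g (t - (M.lifetime x (ω [])).toReal) (M.child x (ω []) j) (shift j ω) else 0 := by
      intro i j
      have h := (hmeas i j).comp (hr i j)
      exact h
    rw [lintegral_tsum fun i => (Measurable.tsum fun j => hmeasr i j).aemeasurable,
      lintegral_tsum fun i => (Measurable.tsum fun j => hmeas' i j).aemeasurable]
    refine tsum_congr fun i => ?_
    rw [lintegral_tsum fun j => (hmeasr i j).aemeasurable,
      lintegral_tsum fun j => (hmeas' i j).aemeasurable]
    refine tsum_congr fun j => ?_
    by_cases hij : i = j
    · simp [hij]
    -- Given the root, the two subtrees are independent, and the mean of the product factors.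
    · refine (lintegral_root_shift_shift hij (hmeas i j)).trans (lintegral_congr fun m => ?_)
      simp only [lintegral_ite_const]
      congr 1
      have hfm : Measurable fun ω => M.W n f (t - (M.lifetime x m).toReal) (M.child x m i) ω :=
        hWf.comp (measurable_const.prodMk (measurable_const.prodMk measurable_id))
      have hgm : Measurable fun ω => M.W n g (t - (M.lifetime x m).toReal) (M.child x m j) ω :=
        hWg.comp (measurable_const.prodMk (measurable_const.prodMk measurable_id))
      simp only [lintegral_const_mul _ hgm]
      rw [lintegral_mul_const _ hfm]
      rfl

end Model

/-! ### The law of the first event -/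

theorem lintegral_noiseLaw {φ : Noise → ℝ≥0∞} (hφ : Measurable φ) :
    ∫⁻ n, φ n ∂noiseLaw = ∫⁻ e₁, ∫⁻ e₂, ∫⁻ u, φ (e₁, e₂, u) ∂volume ∂expMeasure 1 ∂expMeasure 1 := by
  have := isProbabilityMeasure_expMeasure one_pos
  unfold noiseLaw
  rw [lintegral_prod _ hφ.aemeasurable]
  refine lintegral_congr fun e₁ => ?_
  have h : Measurable fun p : ℝ × unitInterval => φ (e₁, p) := by
    have h := hφ.comp (measurable_prodMk_left (x := e₁) (β := ℝ × unitInterval))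
    exact h
  exact lintegral_prod _ h.aemeasurable

theorem lintegral_sampler {Y : Type} [Nonempty Y] [MeasurableSpace Y] [StandardBorelSpace Y]
    (κ : Kernel Phase Y) [IsMarkovKernel κ] (x : Phase) {φ : Y → ℝ≥0∞} (hφ : Measurable φ) :
    ∫⁻ u, φ (sampler κ x u) = ∫⁻ y, φ y ∂(κ x) := by
  have h : Measurable fun u => sampler κ x u := by
    have h := (measurable_sampler κ).comp (measurable_prodMk_left (x := x) (β := unitInterval))
    exact h
  conv_rhs => rw [← map_sampler κ x]
  rw [lintegral_map hφ h]

namespace Model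

variable (M : Model)

/-- The configuration at time `s` of a neutron issued from `x` that is not disturbed. -/
noncomputable def flow (x : Phase) (s : ℝ) : Phase := (x.1 + s • x.2, x.2)

theorem measurable_flow : Measurable fun p : Phase × ℝ => flow p.1 p.2 := measurable_flight

theorem measurable_flow_right (x : Phase) : Measurable (flow x) := by
  have h := measurable_flow.comp (measurable_prodMk_left (x := x) (β := ℝ))
  exact h

theorem flow_mem_domain {x : Phase} (hx : x ∈ M.domain) {s : ℝ}
    (hs : s ∈ Set.Ioo 0 (M.exitTime x).toReal) : flow x s ∈ M.domain :=
  ⟨M.mem_D_of_lt_exitTime hx.1 hs.1.le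
    ((ENNReal.ofReal_lt_iff_lt_toReal hs.1.le (M.exitTime_ne_top hx)).2 hs.2), hx.2⟩

theorem measurable_fissionRate_right (x : Phase) : Measurable (M.fissionRate x) := by
  have h := M.measurable_fissionRate.comp (measurable_prodMk_left (x := x) (β := ℝ))
  exact h

/-- The probability that a neutron issued from `x` is not disturbed before time `s`. -/
noncomputable def alive (x : Phase) (s : ℝ) : ℝ≥0∞ :=
  noiseLaw {n | ENNReal.ofReal s < M.lifetime x n}

theorem measurableSet_lt_lifetime (x : Phase) (s : ℝ) :
    MeasurableSet {n | ENNReal.ofReal s < M.lifetime x n} :=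
  measurableSet_lt measurable_const (M.measurable_lifetime_right x)

open Classical in
theorem firstMean_eq (h : Phase → ℝ≥0∞) (t : ℝ) (x : Phase) :
    M.firstMean h t x = if 0 ≤ t then M.alive x t * h (flow x t) else 0 := by
  unfold firstMean first
  split_ifs with ht
  · simp only [ht, true_and]
    rw [mul_comm, alive, ← lintegral_indicator_const (M.measurableSet_lt_lifetime x t)]
    refine lintegral_congr fun n => ?_
    simp only [Set.indicator_apply, Set.mem_ofPred_eq]
    rfl
  · simp [ht]

theorem alive_of_exitTime_le {x : Phase} {s : ℝ} (h : M.exitTime x ≤ ENNReal.ofReal s) :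
    M.alive x s = 0 := by
  unfold alive
  convert measure_empty (μ := noiseLaw)
  ext n
  simp only [Set.mem_ofPred_eq, Set.mem_empty_iff_false, iff_false, not_lt]
  exact (min_le_right _ _).trans h

theorem alive_eq {x : Phase} {κ : ℝ} (hκ : ENNReal.ofReal κ = M.exitTime x) {C : ℝ≥0}
    (hs : ∀ s ∈ Set.Ioo 0 κ, M.scatterRate x s ≤ C) (hf : ∀ s ∈ Set.Ioo 0 κ, M.fissionRate x s ≤ C)
    {s : ℝ} (hsκ : s ∈ Set.Ioo 0 κ) :
    M.alive x s = survival (M.scatterRate x) s * survival (M.fissionRate x) s := by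
  have := isProbabilityMeasure_expMeasure one_pos
  have hset : {n : Noise | ENNReal.ofReal s < M.lifetime x n} =
      {e | ENNReal.ofReal s < clock (M.scatterRate x) e} ×ˢ
        ({e | ENNReal.ofReal s < clock (M.fissionRate x) e} ×ˢ Set.univ) := by
    ext n
    have h : ENNReal.ofReal s < M.exitTime x := by
      rw [← hκ]
      exact (ENNReal.ofReal_lt_ofReal_iff (hsκ.1.trans hsκ.2)).2 hsκ.2
    simp only [Set.mem_ofPred_eq, Set.mem_prod, Set.mem_univ, and_true, lifetime, lt_min_iff, h]
    rfl
  unfold alive noiseLaw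
  rw [hset, Measure.prod_prod, Measure.prod_prod, measure_univ, mul_one,
    expMeasure_lt_clock hs hsκ.1.le hsκ.2, expMeasure_lt_clock hf hsκ.1.le hsκ.2]

/-- The event that the life of a neutron issued from `x` ends with a fission. -/
def Fission (x : Phase) (n : Noise) : Prop :=
  M.fissionTime x n < M.exitTime x ∧ M.fissionTime x n ≤ M.scatterTime x n

theorem measurableSet_fission (x : Phase) : MeasurableSet {n | M.Fission x n} := by
  have hs : Measurable fun n => M.scatterTime x n := by
    have h := M.measurable_scatterTime.comp (measurable_prodMk_left (x := x) (β := Noise))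
    exact h
  have hf : Measurable fun n => M.fissionTime x n := by
    have h := M.measurable_fissionTime.comp (measurable_prodMk_left (x := x) (β := Noise))
    exact h
  exact (measurableSet_lt hf measurable_const).inter (measurableSet_le hf hs)

theorem lifetime_of_fission {x : Phase} {n : Noise} (h : M.Fission x n) :
    M.lifetime x n = M.fissionTime x n := by
  unfold lifetime
  rw [min_eq_right h.2, min_eq_left h.1.le]

theorem outgoing_of_fission {x : Phase} {n : Noise} (h : M.Fission x n) :
    M.outgoing x n = sampler M.fission (flow x (M.fissionTime x n).toReal) n.2.2 := by
  unfold outgoing endPoint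
  rw [if_neg (by rw [min_eq_right h.2]; exact not_le.2 h.1), if_neg (not_lt.2 h.2),
    M.lifetime_of_fission h]
  rfl

open Classical in
/-- The law of the first event if it is a fission. -/
theorem lintegral_fission {x : Phase} {κ : ℝ} (hκ0 : 0 ≤ κ) (hκ : ENNReal.ofReal κ = M.exitTime x)
    {C : ℝ≥0} (hs : ∀ s ∈ Set.Ioo 0 κ, M.scatterRate x s ≤ C)
    (hf : ∀ s ∈ Set.Ioo 0 κ, M.fissionRate x s ≤ C)
    {K : ℝ → Velocities → ℝ≥0∞} (hK : Measurable (Function.uncurry K)) :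
    ∫⁻ n, (if M.Fission x n then K (M.lifetime x n).toReal (M.outgoing x n) else 0) ∂noiseLaw =
      ∫⁻ s in Set.Ioo 0 κ, M.alive x s * (M.σf (flow x s) * ∫⁻ z, K s z ∂(M.fission (flow x s))) := by
  have := isProbabilityMeasure_expMeasure one_pos
  set Φ : ℝ → ℝ≥0∞ := fun s => ∫⁻ z, K s z ∂(M.fission (flow x s)) with hΦ
  have hΦm : Measurable Φ := by
    have h : Measurable fun p : ℝ × Phase => ∫⁻ z, K p.1 z ∂(M.fission p.2) := by
      refine Measurable.lintegral_kernel_prod_right'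
        (κ := M.fission.comap (Prod.snd : ℝ × Phase → Phase) measurable_snd)
        (f := fun q : (ℝ × Phase) × Velocities => K q.1.1 q.2) ?_
      have h1 : Measurable fun q : (ℝ × Phase) × Velocities => (q.1.1, q.2) := by fun_prop
      have h2 := hK.comp h1
      exact h2
    have h2 := h.comp (measurable_id.prodMk (measurable_flow_right x))
    exact h2
  have hout : Measurable fun n => M.outgoing x n := by
    have h := M.measurable_outgoing.comp (measurable_prodMk_left (x := x) (β := Noise))
    exact h
  have hmeas : Measurable fun n =>
      if M.Fission x n then K (M.lifetime x n).toReal (M.outgoing x n) else 0 := by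
    refine Measurable.ite (M.measurableSet_fission x) ?_ measurable_const
    have h := hK.comp ((M.measurable_lifetime_right x).ennreal_toReal.prodMk hout)
    exact h
  rw [lintegral_noiseLaw hmeas]
  -- With both clocks frozen, time and place of the fission are fixed, and the uniform variable
  -- turns `sampler` into an integral against the fission kernel there.
  have hinner : ∀ e₁ e₂ : ℝ, ∫⁻ u : unitInterval, (if M.Fission x (e₁, e₂, u) then
      K (M.lifetime x (e₁, e₂, u)).toReal (M.outgoing x (e₁, e₂, u)) else 0) =
      if clock (M.fissionRate x) e₂ < ENNReal.ofReal κ then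
        (if ENNReal.ofReal (clock (M.fissionRate x) e₂).toReal ≤ clock (M.scatterRate x) e₁ then
          Φ (clock (M.fissionRate x) e₂).toReal else 0) else 0 := by
    intro e₁ e₂
    by_cases h : clock (M.fissionRate x) e₂ < ENNReal.ofReal κ ∧
        clock (M.fissionRate x) e₂ ≤ clock (M.scatterRate x) e₁
    · have hF : ∀ u, M.Fission x (e₁, e₂, u) := fun u => ⟨hκ ▸ h.1, h.2⟩
      rw [if_pos h.1, ENNReal.ofReal_toReal h.1.ne_top, if_pos h.2]
      have hKs : Measurable (K (clock (M.fissionRate x) e₂).toReal) := by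
        have h := hK.comp (measurable_prodMk_left (x := (clock (M.fissionRate x) e₂).toReal)
          (β := Velocities))
        exact h
      rw [hΦ]
      simp only
      rw [← lintegral_sampler M.fission _ hKs]
      refine lintegral_congr fun u => ?_
      rw [if_pos (hF u), M.lifetime_of_fission (hF u), M.outgoing_of_fission (hF u)]
      rfl
    · have hF : ∀ u, ¬ M.Fission x (e₁, e₂, u) := fun u hu => h ⟨hκ ▸ hu.1, hu.2⟩
      simp only [hF, if_false, lintegral_zero]
      by_cases h1 : clock (M.fissionRate x) e₂ < ENNReal.ofReal κ
      · rw [if_pos h1, ENNReal.ofReal_toReal h1.ne_top, if_neg fun h2 => h ⟨h1, h2⟩]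
      · rw [if_neg h1]
  simp only [hinner]
  have hjoint : Measurable fun p : ℝ × ℝ =>
      (if ENNReal.ofReal p.2 ≤ clock (M.scatterRate x) p.1 then Φ p.2 else 0) *
        (M.fissionRate x p.2 * survival (M.fissionRate x) p.2) := by
    refine Measurable.mul (Measurable.ite ?_ (hΦm.comp measurable_snd) measurable_const) ?_
    · exact measurableSet_le measurable_snd.ennreal_ofReal
        ((measurable_clock_right _).comp measurable_fst)
    · have h1 : Measurable fun s => (M.fissionRate x s : ℝ≥0∞) * survival (M.fissionRate x) s :=
        (M.measurable_fissionRate_right x).coe_nnreal_ennreal.mul (measurable_survival _)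
      have h2 : Measurable fun p : ℝ × ℝ => p.2 := measurable_snd
      have h := h1.comp h2
      exact h
  have hlaw : ∀ e₁ : ℝ, ∫⁻ e₂, (if clock (M.fissionRate x) e₂ < ENNReal.ofReal κ then
        (if ENNReal.ofReal (clock (M.fissionRate x) e₂).toReal ≤ clock (M.scatterRate x) e₁ then
          Φ (clock (M.fissionRate x) e₂).toReal else 0) else 0) ∂expMeasure 1 =
      ∫⁻ s in Set.Ioo 0 κ, (if ENNReal.ofReal s ≤ clock (M.scatterRate x) e₁ then Φ s else 0) *
        (M.fissionRate x s * survival (M.fissionRate x) s) := fun e₁ =>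
    lintegral_clock (M.measurable_fissionRate_right x) hf hκ0
      (φ := fun s => if ENNReal.ofReal s ≤ clock (M.scatterRate x) e₁ then Φ s else 0)
      (Measurable.ite (measurableSet_le measurable_id.ennreal_ofReal measurable_const) hΦm
        measurable_const)
  simp only [hlaw]
  -- With the fission time s now outermost, the scattering clock is integrated out. The event that
  -- it has not rung before s has probability `survival`, with ties included, so simultaneous
  -- ringing needs no separate argument.
  rw [lintegral_lintegral_swap hjoint.aemeasurable]
  refine setLIntegral_congr_fun measurableSet_Ioo fun s hs' => ?_
  have hset : MeasurableSet {e | ENNReal.ofReal s ≤ clock (M.scatterRate x) e} :=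
    measurableSet_le measurable_const (measurable_clock_right _)
  have hind : ∀ e₁ : ℝ, (if ENNReal.ofReal s ≤ clock (M.scatterRate x) e₁ then Φ s else 0) *
      (M.fissionRate x s * survival (M.fissionRate x) s) =
      {e | ENNReal.ofReal s ≤ clock (M.scatterRate x) e}.indicator
        (fun _ => Φ s * (M.fissionRate x s * survival (M.fissionRate x) s)) e₁ := by
    intro e₁
    simp only [Set.indicator_apply, Set.mem_ofPred_eq, ite_mul, zero_mul]
  simp only [hind]
  rw [lintegral_indicator_const hset, expMeasure_le_clock (cumulative_ne_top hs hs'.2.le),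
    M.alive_eq hκ hs hf hs']
  change Φ s * (M.σf (flow x s) * survival (M.fissionRate x) s) * survival (M.scatterRate x) s =
    survival (M.scatterRate x) s * survival (M.fissionRate x) s * (M.σf (flow x s) * Φ s)
  ring

/-- The rates are bounded along a flight in `D`. -/
theorem exists_rate_le (hM : M.BoundedCrossSections) : ∃ C : ℝ≥0, ∀ x ∈ M.domain,
    (∀ s ∈ Set.Ioo 0 (M.exitTime x).toReal, M.scatterRate x s ≤ C) ∧
      ∀ s ∈ Set.Ioo 0 (M.exitTime x).toReal, M.fissionRate x s ≤ C := by
  obtain ⟨C, hC⟩ := hM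
  exact ⟨C, fun x hx => ⟨fun s hs => (hC _ (M.flow_mem_domain hx hs)).1,
    fun s hs => (hC _ (M.flow_mem_domain hx hs)).2.1⟩⟩

open Classical in
theorem lintegral_fission_of_mem_domain (hM : M.BoundedCrossSections) {x : Phase}
    (hx : x ∈ M.domain) {K : ℝ → Velocities → ℝ≥0∞} (hK : Measurable (Function.uncurry K)) :
    ∫⁻ n, (if M.Fission x n then K (M.lifetime x n).toReal (M.outgoing x n) else 0) ∂noiseLaw =
      ∫⁻ s in Set.Ioo 0 (M.exitTime x).toReal,
        M.alive x s * (M.σf (flow x s) * ∫⁻ z, K s z ∂(M.fission (flow x s))) := by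
  obtain ⟨C, hC⟩ := M.exists_rate_le hM
  exact M.lintegral_fission ENNReal.toReal_nonneg (ENNReal.ofReal_toReal (M.exitTime_ne_top hx))
    (hC x hx).1 (hC x hx).2 hK

/-! ### Successors stay in D × V -/

theorem card_le_one_of_not_fission {x : Phase} {n : Noise} (h : ¬ M.Fission x n) :
    M.card x n ≤ 1 := by
  unfold card outgoing
  split_ifs with h1 h2
  · simp
  · simp
  · rw [min_eq_right (not_lt.1 h2), not_le] at h1
    exact absurd ⟨h1, not_lt.1 h2⟩ h

/-- Test the identity for πf with the indicator of the complement of V: the integral over V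
vanishes, so the expected number of velocities outside V is zero. -/
theorem ae_vel_mem {y : Phase} (hy : y ∈ M.domain) :
    ∀ᵐ z ∂(M.fission y), ∀ i < z.1, vel z i ∈ M.V := by
  have hV : MeasurableSet (velocitySpace M.vmin M.vmax) := M.measurableSet_V
  have hm : Measurable ((M.Vᶜ).indicator fun _ => (1 : ℝ≥0∞)) :=
    measurable_const.indicator M.measurableSet_V.compl
  have h := M.lintegral_πf y hy _ hm
  have h0 : ∫⁻ v' in velocitySpace M.vmin M.vmax,
      (M.Vᶜ).indicator (fun _ => (1 : ℝ≥0∞)) v' * (M.πf y v' : ℝ≥0∞) = 0 := by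
    rw [setLIntegral_congr_fun (g := fun _ => 0) hV]
    · simp
    · intro v hv
      have : v ∉ M.Vᶜ := fun h => h hv
      simp [this]
  rw [h0] at h
  have hm2 : Measurable fun z : Velocities =>
      ∑ i, (M.Vᶜ).indicator (fun _ => (1 : ℝ≥0∞)) (z.2 i) := by
    refine measurable_of_velocities fun n => ?_
    have h : ∀ i : Fin n, Measurable fun y : Fin n → Space =>
        (M.Vᶜ).indicator (fun _ => (1 : ℝ≥0∞)) (y i) := fun i => hm.comp (measurable_pi_apply i)
    exact Finset.measurable_fun_sum Finset.univ fun i _ => h i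
  filter_upwards [(lintegral_eq_zero_iff hm2).1 h.symm] with z hz i hi
  have hz' : ∑ i, (M.Vᶜ).indicator (fun _ => (1 : ℝ≥0∞)) (z.2 i) = 0 := hz
  rw [Finset.sum_eq_zero_iff] at hz'
  have := hz' ⟨i, hi⟩ (Finset.mem_univ _)
  rw [Set.indicator_apply_eq_zero] at this
  by_contra hc
  refine one_ne_zero (this ?_)
  rw [← vel_fin z ⟨i, hi⟩]
  exact hc

theorem measurable_outgoing_right (x : Phase) : Measurable fun n => M.outgoing x n := by
  have h := M.measurable_outgoing.comp (measurable_prodMk_left (x := x) (β := Noise))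
  exact h

theorem measurable_endPoint_right (x : Phase) : Measurable fun n => M.endPoint x n := by
  have h := M.measurable_endPoint.comp (measurable_prodMk_left (x := x) (β := Noise))
  exact h

theorem endPoint_mem {x : Phase} (hx : x ∈ M.domain) {n : Noise}
    (h : M.lifetime x n < M.exitTime x) : M.endPoint x n ∈ M.D :=
  M.mem_D_of_lt_exitTime hx.1 ENNReal.toReal_nonneg (by rwa [ENNReal.ofReal_toReal h.ne_top])

theorem scattering_compl_V {y : Phase} (hy : y ∈ M.domain) : M.scattering y M.Vᶜ = 0 := by
  classical
  have hm : Measurable (Function.uncurry fun (x : Phase) (v' : Space) => (M.πs x v' : ℝ≥0∞)) :=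
    measurable_coe_nnreal_ennreal.comp M.measurable_πs
  unfold scattering
  rw [Kernel.piecewise_apply, if_pos hy, Kernel.withDensity_apply _ hm]
  refine withDensity_absolutelyContinuous _ _ ?_
  rw [Kernel.const_apply, Measure.restrict_apply M.measurableSet_V.compl]
  simp

-- Given the clocks, the new velocity has the scattering law at the end point. A scattering before
-- the exit takes place in D, and there this law does not charge the complement of V.
open Classical in
theorem ae_scatter_mem {x : Phase} (hx : x ∈ M.domain) :
    ∀ᵐ n ∂noiseLaw, M.scatterTime x n < M.fissionTime x n ∧ M.scatterTime x n < M.exitTime x →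
      sampler M.scattering (M.endPoint x n, x.2) n.2.2 ∈ M.V := by
  have hs : Measurable fun n => M.scatterTime x n := by
    have h := M.measurable_scatterTime.comp (measurable_prodMk_left (x := x) (β := Noise))
    exact h
  have hf : Measurable fun n => M.fissionTime x n := by
    have h := M.measurable_fissionTime.comp (measurable_prodMk_left (x := x) (β := Noise))
    exact h
  have hind : Measurable ((M.Vᶜ).indicator fun _ => (1 : ℝ≥0∞)) :=
    measurable_const.indicator M.measurableSet_V.compl
  have hsam : Measurable fun n : Noise => sampler M.scattering (M.endPoint x n, x.2) n.2.2 := by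
    have h1 : Measurable fun n : Noise => n.2.2 := by fun_prop
    have h := (measurable_sampler M.scattering).comp
      (((M.measurable_endPoint_right x).prodMk (measurable_const (a := x.2))).prodMk h1)
    exact h
  have hm : Measurable fun n : Noise =>
      if M.scatterTime x n < M.fissionTime x n ∧ M.scatterTime x n < M.exitTime x then
        (M.Vᶜ).indicator (fun _ => (1 : ℝ≥0∞)) (sampler M.scattering (M.endPoint x n, x.2) n.2.2)
      else 0 := by
    have h := hind.comp hsam
    exact Measurable.ite ((measurableSet_lt hs hf).inter (measurableSet_lt hs measurable_const)) h
      measurable_const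
  have h0 : ∫⁻ n, (if M.scatterTime x n < M.fissionTime x n ∧ M.scatterTime x n < M.exitTime x then
        (M.Vᶜ).indicator (fun _ => (1 : ℝ≥0∞)) (sampler M.scattering (M.endPoint x n, x.2) n.2.2)
      else 0) ∂noiseLaw = 0 := by
    rw [lintegral_noiseLaw hm]
    have : ∀ e₁ e₂ : ℝ, ∫⁻ u : unitInterval, (if M.scatterTime x (e₁, e₂, u) <
        M.fissionTime x (e₁, e₂, u) ∧ M.scatterTime x (e₁, e₂, u) < M.exitTime x then
        (M.Vᶜ).indicator (fun _ => (1 : ℝ≥0∞))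
          (sampler M.scattering (M.endPoint x (e₁, e₂, u), x.2) u)
      else 0) = 0 := by
      intro e₁ e₂
      by_cases h : M.scatterTime x (e₁, e₂, 0) < M.fissionTime x (e₁, e₂, 0) ∧
          M.scatterTime x (e₁, e₂, 0) < M.exitTime x
      · have hu : ∀ u : unitInterval, M.scatterTime x (e₁, e₂, u) < M.fissionTime x (e₁, e₂, u) ∧
          M.scatterTime x (e₁, e₂, u) < M.exitTime x := fun u => h
        have hend : M.endPoint x (e₁, e₂, 0) ∈ M.D := by
          refine M.endPoint_mem hx (lt_of_le_of_lt ?_ h.2)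
          exact (min_le_left _ _).trans (min_le_left _ _)
        simp only [hu, and_self, if_true]
        refine (lintegral_sampler M.scattering (M.endPoint x (e₁, e₂, 0), x.2) hind).trans ?_
        rw [lintegral_indicator_const M.measurableSet_V.compl, one_mul]
        exact M.scattering_compl_V ⟨hend, hx.2⟩
      · have hu : ∀ u : unitInterval,
            ¬ (M.scatterTime x (e₁, e₂, u) < M.fissionTime x (e₁, e₂, u) ∧
          M.scatterTime x (e₁, e₂, u) < M.exitTime x) := fun u => h
        simp only [hu, if_false, lintegral_zero]
    simp only [this, lintegral_zero]
  filter_upwards [(lintegral_eq_zero_iff hm).1 h0] with n hn hc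
  simp only [hc, and_self, if_true, Pi.zero_apply] at hn
  rw [Set.indicator_apply_eq_zero] at hn
  by_contra hV
  exact one_ne_zero (hn hV)

-- The law of the first fission is applied to the indicator of the families with a velocity outside
-- V; each fission kernel met along the flight gives it mass zero.
open Classical in
theorem ae_fission_mem (hM : M.BoundedCrossSections) {x : Phase} (hx : x ∈ M.domain) :
    ∀ᵐ n ∂noiseLaw, M.Fission x n →
      ∀ i < (M.outgoing x n).1, vel (M.outgoing x n) i ∈ M.V := by
  set B : Set Velocities := {z | ∀ i < z.1, vel z i ∈ M.V}ᶜ with hB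
  have hBm : MeasurableSet B := by
    have h : {z : Velocities | ∀ i < z.1, vel z i ∈ M.V} =
        ⋂ i, {z | i < z.1}ᶜ ∪ (fun z => vel z i) ⁻¹' M.V := by
      ext z
      simp only [Set.mem_ofPred_eq, Set.mem_iInter, Set.mem_union, Set.mem_compl_iff,
        Set.mem_preimage]
      exact forall_congr' fun i => by tauto
    rw [hB, h]
    exact (MeasurableSet.iInter fun i =>
      (measurableSet_lt measurable_const measurable_velocities_card).compl.union
        (measurable_vel i M.measurableSet_V)).compl
  have hind : Measurable (B.indicator fun _ => (1 : ℝ≥0∞)) := measurable_const.indicator hBm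
  have hK : Measurable (Function.uncurry fun (_ : ℝ) z => B.indicator (fun _ => (1 : ℝ≥0∞)) z) := by
    have h1 : Measurable fun p : ℝ × Velocities => p.2 := measurable_snd
    have h := hind.comp h1
    exact h
  have h0 := M.lintegral_fission_of_mem_domain hM hx hK
  rw [setLIntegral_congr_fun (g := fun _ => 0) measurableSet_Ioo, lintegral_zero] at h0
  · have hm : Measurable fun n => if M.Fission x n then
        B.indicator (fun _ => (1 : ℝ≥0∞)) (M.outgoing x n) else 0 := by
      have h := hind.comp (M.measurable_outgoing_right x)
      exact Measurable.ite (M.measurableSet_fission x) h measurable_const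
    filter_upwards [(lintegral_eq_zero_iff hm).1 h0] with n hn hF
    simp only [hF, if_true, Pi.zero_apply] at hn
    rw [Set.indicator_apply_eq_zero] at hn
    by_contra hV
    exact one_ne_zero (hn hV)
  · intro s hs
    simp only
    rw [lintegral_indicator_const hBm, one_mul]
    have : M.fission (flow x s) B = 0 := M.ae_vel_mem (M.flow_mem_domain hx hs)
    rw [this, mul_zero, mul_zero]

/-- The neutrons that replace the initial one have configurations in `D × V`. -/
theorem ae_child_mem (hM : M.BoundedCrossSections) {x : Phase} (hx : x ∈ M.domain) :
    ∀ᵐ n ∂noiseLaw, ∀ i < M.card x n, M.child x n i ∈ M.domain := by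
  filter_upwards [M.ae_scatter_mem hx, M.ae_fission_mem hM hx] with n h1 h2 i hi
  by_cases hF : M.Fission x n
  · refine ⟨M.endPoint_mem hx ?_, h2 hF i hi⟩
    rw [M.lifetime_of_fission hF]
    exact hF.1
  by_cases he : M.exitTime x ≤ min (M.scatterTime x n) (M.fissionTime x n)
  · simp [card, outgoing, he] at hi
  have hlt : M.scatterTime x n < M.fissionTime x n := by
    by_contra hlt
    rw [min_eq_right (not_lt.1 hlt), not_le] at he
    exact hF ⟨he, not_lt.1 hlt⟩
  rw [min_eq_left hlt.le, not_le] at he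
  have hout : M.outgoing x n =
      ⟨1, fun _ => sampler M.scattering (M.endPoint x n, x.2) n.2.2⟩ := by
    unfold outgoing
    rw [min_eq_left hlt.le, if_neg (not_le.2 he), if_pos hlt]
  refine ⟨M.endPoint_mem hx (lt_of_le_of_lt ((min_le_left _ _).trans (min_le_left _ _)) he), ?_⟩
  rw [card, hout] at hi
  have h3 := h1 ⟨hlt, he⟩
  unfold child
  rw [hout]
  simpa [vel, hi] using h3

/-- Comparison on D × V suffices, as successors almost surely lie there. This keeps the inductions
inside the set where the model is constrained. -/
theorem branch_mono (hM : M.BoundedCrossSections) {x : Phase} (hx : x ∈ M.domain)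
    {Φ Ψ : ℝ → Phase → ℝ≥0∞} (h : ∀ s, ∀ y ∈ M.domain, Φ s y ≤ Ψ s y) (t : ℝ) :
    M.branch Φ t x ≤ M.branch Ψ t x := by
  refine lintegral_mono_ae ?_
  filter_upwards [M.ae_child_mem hM hx] with n hn
  refine ENNReal.tsum_le_tsum fun i => ?_
  split_ifs with hi
  · exact h _ _ (hn i hi)
  · exact le_rfl

theorem pairs_mono {Φ Φ' Ψ Ψ' : ℝ → Phase → ℝ≥0∞} (h : ∀ s y, Φ s y ≤ Φ' s y)
    (h' : ∀ s y, Ψ s y ≤ Ψ' s y) (t : ℝ) (x : Phase) : M.pairs Φ Ψ t x ≤ M.pairs Φ' Ψ' t x := by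
  refine lintegral_mono fun n => ENNReal.tsum_le_tsum fun i => ENNReal.tsum_le_tsum fun j => ?_
  split_ifs
  · exact mul_le_mul' (h _ _) (h' _ _)
  · exact le_rfl

/-! ### Pairs of siblings as a time integral of η_f -/

theorem sum_offdiag_eq_tsum (z : Velocities) (a b : Space → ℝ≥0∞) :
    (∑ i, ∑ j, if i ≠ j then a (z.2 i) * b (z.2 j) else 0) =
      ∑' i : ℕ, ∑' j : ℕ, if i ≠ j ∧ i < z.1 ∧ j < z.1 then a (vel z i) * b (vel z j) else 0 := by
  rw [sum_fin_eq_tsum (ψ := fun i : ℕ => ∑' j : ℕ, if j < z.1 then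
    (if i ≠ j then a (vel z i) * b (vel z j) else 0) else 0)]
  · refine tsum_congr fun i => ?_
    split_ifs with hi
    · refine tsum_congr fun j => ?_
      by_cases hj : j < z.1 <;> by_cases hij : i = j <;> simp [hi, hj, hij]
    · simp [hi]
  · intro i
    refine sum_fin_eq_tsum fun j => ?_
    simp only [vel_fin, ne_eq, Fin.ext_iff]

/-- The sum over pairs of distinct neutrons born at position `y.1` with velocities `z`. -/
noncomputable def offdiag (Φ Ψ : ℝ → Phase → ℝ≥0∞) (q : (ℝ × Phase) × Velocities) : ℝ≥0∞ :=
  ∑' i : ℕ, ∑' j : ℕ, if i ≠ j ∧ i < q.2.1 ∧ j < q.2.1 then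
    Φ q.1.1 (q.1.2.1, vel q.2 i) * Ψ q.1.1 (q.1.2.1, vel q.2 j) else 0

theorem measurable_offdiag {Φ Ψ : ℝ → Phase → ℝ≥0∞} (hΦ : Measurable (Function.uncurry Φ))
    (hΨ : Measurable (Function.uncurry Ψ)) : Measurable (offdiag Φ Ψ) := by
  have hv : ∀ i, Measurable fun q : (ℝ × Phase) × Velocities =>
      (q.1.1, ((q.1.2.1, vel q.2 i) : Phase)) := fun i => by
    have h1 : Measurable fun q : (ℝ × Phase) × Velocities => vel q.2 i :=
      (measurable_vel i).comp measurable_snd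
    have h2 : Measurable fun q : (ℝ × Phase) × Velocities => q.1.1 := by fun_prop
    have h3 : Measurable fun q : (ℝ × Phase) × Velocities => q.1.2.1 := by fun_prop
    exact h2.prodMk (h3.prodMk h1)
  have hc : ∀ i : ℕ, MeasurableSet {q : (ℝ × Phase) × Velocities | i < q.2.1} := fun i =>
    measurableSet_lt measurable_const (measurable_velocities_card.comp measurable_snd)
  unfold offdiag
  refine Measurable.tsum fun i => Measurable.tsum fun j => ?_
  have h1 := hΦ.comp (hv i)
  have h2 := hΨ.comp (hv j)
  exact Measurable.ite ((MeasurableSet.const _).inter ((hc i).inter (hc j))) (h1.mul h2)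
    measurable_const

theorem η_eq_offdiag (Φ Ψ : ℝ → Phase → ℝ≥0∞) (t : ℝ) (x : Phase) :
    M.η (Φ t) (Ψ t) x = M.σf x * ∫⁻ z, offdiag Φ Ψ ((t, x), z) ∂(M.fission x) := by
  unfold η offdiag
  congr 1
  refine lintegral_congr fun z => ?_
  exact sum_offdiag_eq_tsum z (fun v => Φ t (x.1, v)) (fun v => Ψ t (x.1, v))

theorem measurable_η {Φ Ψ : ℝ → Phase → ℝ≥0∞} (hΦ : Measurable (Function.uncurry Φ))
    (hΨ : Measurable (Function.uncurry Ψ)) :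
    Measurable fun p : ℝ × Phase => M.η (Φ p.1) (Ψ p.1) p.2 := by
  simp only [M.η_eq_offdiag Φ Ψ]
  refine Measurable.mul ?_ ?_
  · exact M.measurable_σf.coe_nnreal_ennreal.comp measurable_snd
  · have h := Measurable.lintegral_kernel_prod_right'
      (κ := M.fission.comap (Prod.snd : ℝ × Phase → Phase) measurable_snd)
      (measurable_offdiag hΦ hΨ)
    exact h

/-- Two distinct successors exist only after a fission, so the law of the first fission applies; the
rate σf in its density is the factor σf of η_f. -/
theorem pairs_eq (hM : M.BoundedCrossSections) {x : Phase} (hx : x ∈ M.domain)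
    {Φ Ψ : ℝ → Phase → ℝ≥0∞} (hΦ : Measurable (Function.uncurry Φ))
    (hΨ : Measurable (Function.uncurry Ψ)) (t : ℝ) :
    M.pairs Φ Ψ t x = ∫⁻ s in Set.Ioo 0 (M.exitTime x).toReal,
      M.alive x s * M.η (Φ (t - s)) (Ψ (t - s)) (flow x s) := by
  classical
  have hK : Measurable (Function.uncurry fun (s : ℝ) z => offdiag Φ Ψ ((t - s, flow x s), z)) := by
    have h1 : Measurable fun p : ℝ × Velocities => flow x p.1 :=
      (measurable_flow_right x).comp measurable_fst
    have h2 : Measurable fun p : ℝ × Velocities => t - p.1 := by fun_prop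
    have h := (measurable_offdiag hΦ hΨ).comp ((h2.prodMk h1).prodMk measurable_snd)
    exact h
  simp only [M.η_eq_offdiag Φ Ψ]
  rw [← M.lintegral_fission_of_mem_domain hM hx hK]
  unfold pairs
  refine lintegral_congr fun n => ?_
  split_ifs with hF
  · rfl
  · refine ENNReal.tsum_eq_zero.2 fun i => ENNReal.tsum_eq_zero.2 fun j => if_neg ?_
    have := M.card_le_one_of_not_fission hF
    omega

/-- Before time 0 the integrand is zero, and after the exit from D the initial neutron is dead. The
outcome has the form of the integral in `pairs_eq`, which identifies the sibling term with Duhamel's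
source term. -/
theorem lintegral_firstMean {x : Phase} (hx : x ∈ M.domain) (H : ℝ → Phase → ℝ≥0∞) :
    ∫⁻ s, M.firstMean (H s) s x =
      ∫⁻ s in Set.Ioo 0 (M.exitTime x).toReal, M.alive x s * H s (flow x s) := by
  classical
  rw [← lintegral_indicator measurableSet_Ioo]
  refine lintegral_congr_ae ?_
  filter_upwards [compl_mem_ae_iff.2 (measure_singleton (μ := volume) (0 : ℝ))] with s hs
  have hs0 : s ≠ 0 := hs
  rw [firstMean_eq]
  by_cases h : s ∈ Set.Ioo 0 (M.exitTime x).toReal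
  · rw [Set.indicator_of_mem h, if_pos h.1.le]
  · rw [Set.indicator_of_notMem h]
    split_ifs with h0
    · have h1 : (M.exitTime x).toReal ≤ s := by
        by_contra hlt
        exact h ⟨lt_of_le_of_ne h0 hs0.symm, not_le.1 hlt⟩
      rw [M.alive_of_exitTime_le (ENNReal.le_ofReal_iff_toReal_le (M.exitTime_ne_top hx) h0 |>.2 h1),
        zero_mul]
    · rfl

/-! ### Duhamel's recursion and the many-to-two formula -/

theorem alive_antitone (x : Phase) : Antitone (M.alive x) := fun _ _ hst =>
  measure_mono fun _ hn => lt_of_le_of_lt (ENNReal.ofReal_le_ofReal hst) hn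

/-- The right-hand side of Duhamel's formula, restricted to generations less than `n`. -/
noncomputable def duhamel (n : ℕ∞) (h : Phase → ℝ≥0∞) (H : ℝ × Phase → ℝ≥0∞) (t : ℝ) (x : Phase) :
    ℝ≥0∞ :=
  M.mean n h t x + ∫⁻ s, M.mean n (fun y => H (t - s, y)) s x

theorem measurable_mean_comp {H : ℝ × Phase → ℝ≥0∞} (hH : Measurable H) (n : ℕ∞)
    {α : Type*} [MeasurableSpace α] {a b : α → ℝ} {c : α → Phase} (ha : Measurable a)
    (hb : Measurable b) (hc : Measurable c) :
    Measurable fun p => M.mean n (fun y => H (a p, y)) (b p) (c p) := by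
  have h := (M.measurable_mean hH n).comp (ha.prodMk (hb.prodMk hc))
  exact h

/-- A successor born at time τ sees the horizon t - τ. Substituting s - τ for s restores the source
at t - s and leaves the successor the time s - τ. As the integral runs over the whole line, the
shift creates no boundary terms. -/
theorem branch_duhamel {h : Phase → ℝ≥0∞} (hh : Measurable h) {H : ℝ × Phase → ℝ≥0∞}
    (hH : Measurable H) (n : ℕ∞) (t : ℝ) (x : Phase) :
    M.branch (M.duhamel n h H) t x = M.branch (M.mean n h) t x +
      ∫⁻ s, M.branch (M.mean n fun y => H (t - s, y)) s x := by
  have hmean : Measurable (Function.uncurry (M.mean n h)) := M.measurable_mean_of_measurable hh n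
  have h1 : M.branch (M.duhamel n h H) t x = _ := M.branch_add hmean t x
  rw [h1]
  congr 1
  unfold branch
  have hT : Measurable fun p : ℝ × Noise => (M.lifetime x p.2).toReal :=
    (M.measurable_lifetime_right x).ennreal_toReal.comp measurable_snd
  have hterm : ∀ i, Measurable fun p : ℝ × Noise => if i < M.card x p.2 then
      M.mean n (fun y => H (t - p.1, y)) (p.1 - (M.lifetime x p.2).toReal) (M.child x p.2 i)
      else 0 := by
    intro i
    refine Measurable.ite (measurable_snd (M.measurableSet_lt_card x i)) ?_ measurable_const
    exact M.measurable_mean_comp hH n (measurable_const.sub measurable_fst)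
      (measurable_fst.sub hT) ((M.measurable_child_right x i).comp measurable_snd)
  rw [lintegral_lintegral_swap (Measurable.tsum hterm).aemeasurable]
  refine lintegral_congr fun m => ?_
  have htermm : ∀ i, Measurable fun s : ℝ => if i < M.card x m then
      M.mean n (fun y => H (t - s, y)) (s - (M.lifetime x m).toReal) (M.child x m i) else 0 := by
    intro i
    have h := (hterm i).comp (measurable_prodMk_right (y := m) (α := ℝ))
    exact h
  rw [lintegral_tsum fun i => (htermm i).aemeasurable]
  refine tsum_congr fun i => ?_
  refine Eq.trans ?_ (lintegral_ite_const (i < M.card x m) _).symm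
  refine if_congr Iff.rfl ?_ rfl
  refine (lintegral_sub_right_eq_self (fun s => M.mean n
    (fun y => H (t - (M.lifetime x m).toReal - s, y)) s (M.child x m i))
    (M.lifetime x m).toReal).symm.trans (lintegral_congr fun s => ?_)
  simp only [sub_sub, add_sub_cancel]

theorem duhamel_succ {h : Phase → ℝ≥0∞} (hh : Measurable h) {H : ℝ × Phase → ℝ≥0∞}
    (hH : Measurable H) (n : ℕ∞) (t : ℝ) (x : Phase) :
    M.duhamel (n + 1) h H t x = M.firstMean h t x + M.branch (M.duhamel n h H) t x +
      ∫⁻ s, M.firstMean (fun y => H (t - s, y)) s x := by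
  classical
  have hfm : Measurable fun s => M.firstMean (fun y => H (t - s, y)) s x := by
    simp only [firstMean_eq]
    refine Measurable.ite measurableSet_Ici ((M.alive_antitone x).measurable.mul ?_)
      measurable_const
    have h := hH.comp ((measurable_const (a := t)).sub measurable_id |>.prodMk
      (measurable_flow_right x))
    exact h
  have hsucc : ∀ s, M.mean (n + 1) (fun y => H (t - s, y)) s x =
      M.firstMean (fun y => H (t - s, y)) s x + M.branch (M.mean n fun y => H (t - s, y)) s x := by
    intro s
    have h := hH.comp (measurable_prodMk_left (x := t - s) (β := Phase))
    exact M.mean_succ h n s x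
  rw [M.branch_duhamel hh hH]
  conv_lhs => unfold duhamel
  simp only [hsucc]
  rw [M.mean_succ hh, lintegral_add_left hfm]
  ring

theorem duhamel_zero (h : Phase → ℝ≥0∞) (H : ℝ × Phase → ℝ≥0∞) (t : ℝ) (x : Phase) :
    M.duhamel 0 h H t x = 0 := by
  simp [duhamel, mean_zero]

theorem iSup_duhamel {h : Phase → ℝ≥0∞} (hh : Measurable h) {H : ℝ × Phase → ℝ≥0∞}
    (hH : Measurable H) (t : ℝ) (x : Phase) :
    ⨆ n : ℕ, M.duhamel n h H t x = M.duhamel ⊤ h H t x := by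
  have hsec : ∀ s, Measurable fun y => H (t - s, y) := fun s => by
    have h := hH.comp (measurable_prodMk_left (x := t - s) (β := Phase))
    exact h
  have hmono : ∀ (k : Phase → ℝ≥0∞) (s : ℝ), Monotone fun n : ℕ => M.mean n k s x :=
    fun k s m n hmn => M.mean_mono k s x (by exact_mod_cast hmn)
  unfold duhamel
  rw [← ENNReal.iSup_add_iSup_of_monotone (hmono _ _), M.iSup_mean hh, ← lintegral_iSup]
  · congr 1
    refine lintegral_congr fun s => M.iSup_mean (hsec s) s x
  · intro n
    exact M.measurable_mean_comp hH n (measurable_const.sub measurable_id) measurable_id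
      measurable_const
  · intro m n hmn s
    exact hmono _ _ hmn
  · intro m n hmn
    exact lintegral_mono fun s => hmono _ _ hmn

/-- The many-to-two formula. -/
theorem second_eq_duhamel (hM : M.BoundedCrossSections) {f g : Phase → ℝ≥0∞} (hf : Measurable f)
    (hg : Measurable g) (t : ℝ) {x : Phase} (hx : x ∈ M.domain) :
    M.second ⊤ f g t x = M.duhamel ⊤ (fun y => f y * g y)
      (fun p => M.η (M.mean ⊤ f p.1) (M.mean ⊤ g p.1) p.2) t x := by
  have hmf : Measurable (Function.uncurry (M.mean ⊤ f)) := M.measurable_mean_of_measurable hf ⊤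
  have hmg : Measurable (Function.uncurry (M.mean ⊤ g)) := M.measurable_mean_of_measurable hg ⊤
  have hH := M.measurable_η hmf hmg
  have hfg : Measurable fun y => f y * g y := hf.mul hg
  set H : ℝ × Phase → ℝ≥0∞ := fun p => M.η (M.mean ⊤ f p.1) (M.mean ⊤ g p.1) p.2 with hHdef
  have hpairs : ∀ t, ∀ x ∈ M.domain, M.pairs (M.mean ⊤ f) (M.mean ⊤ g) t x =
      ∫⁻ s, M.firstMean (fun y => H (t - s, y)) s x := fun t x hx => by
    rw [M.pairs_eq hM hx hmf hmg, M.lintegral_firstMean hx fun s y => H (t - s, y)]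
  -- The recursion of `second n` has truncated means in the sibling term. Enlarging them to full
  -- means costs an inequality, in the direction required here.
  have hle : ∀ n : ℕ, ∀ t, ∀ x ∈ M.domain,
      M.second n f g t x ≤ M.duhamel n (fun y => f y * g y) H t x := by
    intro n
    induction n with
    | zero => intro t x _; simp [second_zero]
    | succ n ih =>
      intro t x hx
      rw [Nat.cast_succ, M.second_succ hf hg, M.duhamel_succ hfg hH, ← hpairs t x hx]
      gcongr
      · exact M.branch_mono hM hx ih t
      · exact M.pairs_mono (fun s y => M.mean_mono f s y le_top)
          (fun s y => M.mean_mono g s y le_top) t x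
  -- Since ⊤ + 1 = ⊤, the untruncated second moment solves its recursion with exactly the source of
  -- `duhamel`. Iteration of the latter from 0 therefore stays below it.
  have hge : ∀ n : ℕ, ∀ t, ∀ x ∈ M.domain,
      M.duhamel n (fun y => f y * g y) H t x ≤ M.second ⊤ f g t x := by
    intro n
    induction n with
    | zero => intro t x _; simp [duhamel_zero]
    | succ n ih =>
      intro t x hx
      rw [Nat.cast_succ, ← top_add (1 : ℕ∞), M.second_succ hf hg, M.duhamel_succ hfg hH,
        ← hpairs t x hx]
      gcongr
      exact M.branch_mono hM hx ih t
  refine le_antisymm ?_ ?_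
  · rw [← M.iSup_second hf hg, ← M.iSup_duhamel hfg hH]
    exact iSup_mono fun n => hle n t x hx
  · rw [← M.iSup_duhamel hfg hH]
    exact iSup_le fun n => hge n t x hx

theorem η_zero_left (k : Phase → ℝ≥0∞) (x : Phase) : M.η (fun _ => 0) k x = 0 := by
  simp [η]

/-- For s < 0 the outer mean vanishes. For s > t the inner means are taken at a negative time, so
η_f vanishes. -/
theorem lintegral_mean_η_eq (f g : Phase → ℝ≥0∞) (t : ℝ) (x : Phase) :
    ∫⁻ s, M.mean ⊤ (fun y => M.η (M.mean ⊤ f (t - s)) (M.mean ⊤ g (t - s)) y) s x =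
      ∫⁻ s in Set.Icc 0 t, M.ψ s (M.η (M.ψ (t - s) f) (M.ψ (t - s) g)) x := by
  rw [← lintegral_indicator measurableSet_Icc]
  refine lintegral_congr fun s => ?_
  by_cases h : s ∈ Set.Icc 0 t
  · rw [Set.indicator_of_mem h, mean_top]
    have : ∀ k : Phase → ℝ≥0∞, M.mean ⊤ k (t - s) = M.ψ (t - s) k := fun k =>
      funext fun y => M.mean_top k _ y
    rw [this, this]
  · rw [Set.indicator_of_notMem h]
    rcases lt_or_ge s 0 with h0 | h0
    · exact M.mean_of_neg h0
    · have h1 : t - s < 0 := by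
        by_contra h1
        exact h ⟨h0, by linarith⟩
      have h2 : M.mean ⊤ f (t - s) = fun _ => 0 := funext fun y => M.mean_of_neg h1
      simp only [h2, η_zero_left]
      simp [mean_top, ψ]

end Model

/-! ### Exponential growth of the mean and finiteness -/

open Classical in
/-- Exponential growth from time `0` on. -/
noncomputable def growth (K : ℝ≥0) (t : ℝ) : ℝ≥0∞ :=
  if 0 ≤ t then ENNReal.ofReal (Real.exp (K * t)) else 0

theorem growth_of_nonneg (K : ℝ≥0) {t : ℝ} (ht : 0 ≤ t) :
    growth K t = ENNReal.ofReal (Real.exp (K * t)) := if_pos ht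

theorem growth_of_neg (K : ℝ≥0) {t : ℝ} (ht : t < 0) : growth K t = 0 := if_neg (not_le.2 ht)

theorem growth_mono (K : ℝ≥0) : Monotone (growth K) := by
  intro s t hst
  rcases lt_or_ge s 0 with h | h
  · simp [growth_of_neg K h]
  · rw [growth_of_nonneg K h, growth_of_nonneg K (h.trans hst)]
    gcongr

theorem growth_ne_top (K : ℝ≥0) (t : ℝ) : growth K t ≠ ∞ := by
  unfold growth
  split_ifs
  · exact ENNReal.ofReal_ne_top
  · exact ENNReal.zero_ne_top

theorem lintegral_growth (K : ℝ≥0) {t m : ℝ} (hm : 0 ≤ m) (hmt : m ≤ t) :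
    ∫⁻ s in Set.Ioc 0 m, K * growth K (t - s) =
      ENNReal.ofReal (Real.exp (K * t) - Real.exp (K * (t - m))) := by
  have hderiv : ∀ s ∈ Set.uIcc 0 m, HasDerivAt (fun s => -Real.exp (K * (t - s)))
      (K * Real.exp (K * (t - s))) s := by
    intro s _
    have h1 : HasDerivAt (fun s => (K : ℝ) * (t - s)) (K * (-1)) s :=
      ((hasDerivAt_id s).const_sub t).const_mul _
    have h2 := h1.exp.neg
    convert! h2 using 1
    ring
  have hcont : Continuous fun s => (K : ℝ) * Real.exp (K * (t - s)) := by fun_prop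
  have hint := intervalIntegral.integral_eq_sub_of_hasDerivAt hderiv
    (hcont.intervalIntegrable 0 m)
  have hval : Real.exp (K * t) - Real.exp (K * (t - m)) =
      ∫ s in (0 : ℝ)..m, K * Real.exp (K * (t - s)) := by
    rw [hint]; ring_nf
  rw [hval, intervalIntegral.integral_of_le hm, ofReal_integral_eq_lintegral_ofReal]
  · refine setLIntegral_congr_fun measurableSet_Ioc fun s hs => ?_
    rw [growth_of_nonneg K (by linarith [hs.2]), ENNReal.ofReal_mul K.coe_nonneg, ENNReal.ofReal_coe_nnreal]
  · exact (intervalIntegrable_iff_integrableOn_Ioc_of_le hm).1 (hcont.intervalIntegrable 0 m)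
  · exact Filter.Eventually.of_forall fun s => by positivity

namespace Model

variable (M : Model)

open Classical in
theorem branch_const (φ : ℝ → ℝ≥0∞) (t : ℝ) (x : Phase) :
    M.branch (fun s _ => φ s) t x =
      ∫⁻ n, M.card x n * φ (t - (M.lifetime x n).toReal) ∂noiseLaw := by
  unfold branch
  refine lintegral_congr fun n => ?_
  rw [← sum_fin_eq_tsum (n := M.card x n)
    (φ := fun _ => φ (t - (M.lifetime x n).toReal)) fun _ => rfl]
  simp

theorem lifetime_ne_top {x : Phase} (hx : x ∈ M.domain) (n : Noise) : M.lifetime x n ≠ ∞ :=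
  ne_top_of_le_ne_top (M.exitTime_ne_top hx) (min_le_right _ _)

-- This is a pathwise form of Gronwall's argument. With τ the lifetime and m = min t τ, the initial
-- neutron together with a single successor is worth at most c exp(K(t - m)). The time integral over
-- the life is worth at most c (exp(Kt) - exp(K(t - m))), and the sum telescopes. In the mean, that
-- integral pays for the fission neutrons.
open Classical in
theorem first_add_le {h : Phase → ℝ≥0∞} {c : ℝ≥0} (hc : ∀ y ∈ M.domain, h y ≤ c) (K : ℝ≥0)
    {t : ℝ} (ht : 0 ≤ t) {x : Phase} (hx : x ∈ M.domain) (n : Noise) :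
    M.first h t x n + (c * growth K (t - (M.lifetime x n).toReal) +
      ∫⁻ s in Set.Ioi 0, (if ENNReal.ofReal s < M.lifetime x n then
        c * (K * growth K (t - s)) else 0)) ≤ c * growth K t := by
  set τ := (M.lifetime x n).toReal with hτ
  have hτ0 : 0 ≤ τ := ENNReal.toReal_nonneg
  have hT := M.lifetime_ne_top hx n
  set m := min t τ with hm
  have hm0 : 0 ≤ m := le_min ht hτ0
  have hmt : m ≤ t := min_le_left _ _
  -- Only one of the two terms is nonzero: the first if t < τ, the second if t ≥ τ. At t = τ the
  -- initial neutron already counts as dead.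
  have h1 : M.first h t x n + c * growth K (t - τ) ≤ c * ENNReal.ofReal (Real.exp (K * (t - m))) := by
    rcases lt_or_ge t τ with hlt | hge
    · rw [growth_of_neg K (by linarith), mul_zero, add_zero, hm, min_eq_left hlt.le, sub_self,
        mul_zero, Real.exp_zero, ENNReal.ofReal_one, mul_one]
      unfold first
      split_ifs with hcond
      · exact hc _ ⟨M.mem_D_of_lt_exitTime hx.1 ht (hcond.2.trans_le (min_le_right _ _)), hx.2⟩
      · exact zero_le
    · have : M.first h t x n = 0 := by
        unfold first
        refine if_neg fun hcond => ?_
        have := (ENNReal.ofReal_lt_iff_lt_toReal ht hT).1 hcond.2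
        linarith
      rw [this, zero_add, hm, min_eq_right hge, growth_of_nonneg K (by linarith)]
  have h2 : ∫⁻ s in Set.Ioi 0, (if ENNReal.ofReal s < M.lifetime x n then
        c * (K * growth K (t - s)) else 0) ≤
      c * ENNReal.ofReal (Real.exp (K * t) - Real.exp (K * (t - m))) := by
    have hg : Measurable fun s => K * growth K (t - s) :=
      ((growth_mono K).measurable.comp (measurable_const.sub measurable_id)).const_mul _
    rw [← lintegral_growth K hm0 hmt]
    rw [← lintegral_const_mul _ hg, ← lintegral_indicator measurableSet_Ioi,
      ← lintegral_indicator measurableSet_Ioc]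
    refine lintegral_mono fun s => ?_
    simp only [Set.indicator_apply, Set.mem_Ioi, Set.mem_Ioc]
    split_ifs with h0 hcond hsm hsm
    · exact le_rfl
    · have hs : s < τ := (ENNReal.ofReal_lt_iff_lt_toReal h0.le hT).1 hcond
      have : t < s := by
        by_contra hts
        exact hsm ⟨h0, le_min (not_lt.1 hts) hs.le⟩
      rw [growth_of_neg K (by linarith), mul_zero, mul_zero]
    all_goals exact zero_le
  have h3 : Real.exp (K * (t - m)) ≤ Real.exp (K * t) := by
    refine Real.exp_le_exp.2 (mul_le_mul_of_nonneg_left (by linarith) K.2)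
  calc _ = (M.first h t x n + c * growth K (t - τ)) + _ := (add_assoc _ _ _).symm
    _ ≤ c * ENNReal.ofReal (Real.exp (K * (t - m))) +
        c * ENNReal.ofReal (Real.exp (K * t) - Real.exp (K * (t - m))) := add_le_add h1 h2
    _ = c * growth K t := by
        rw [← mul_add, ← ENNReal.ofReal_add (Real.exp_pos _).le (sub_nonneg.2 h3),
          growth_of_nonneg K ht, add_sub_cancel]

open Classical in
/-- If the number of fission neutrons is bounded, then the mean grows at most exponentially. -/
theorem mean_le_growth (hM : M.BoundedCrossSections) {C : ℝ≥0} {N : ℕ}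
    (hC : ∀ y ∈ M.domain, M.σf y ≤ C) (hN : ∀ y ∈ M.domain, ∀ᵐ z ∂(M.fission y), z.1 ≤ N)
    {h : Phase → ℝ≥0∞} (hh : Measurable h) {c : ℝ≥0} (hc : ∀ y ∈ M.domain, h y ≤ c) (n : ℕ) :
    ∀ t, ∀ x ∈ M.domain, M.mean n h t x ≤ c * growth (C * N) t := by
  induction n with
  | zero => intro t x _; simp [mean_zero]
  | succ n ih =>
    intro t x hx
    rcases lt_or_ge t 0 with ht | ht
    · simp [M.mean_of_neg ht]
    set K : ℝ≥0 := C * N with hK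
    have hgm : Measurable (growth K) := (growth_mono K).measurable
    have hlife : Measurable fun m => growth K (t - (M.lifetime x m).toReal) :=
      hgm.comp (measurable_const.sub (M.measurable_lifetime_right x).ennreal_toReal)
    -- At a fission rate at most C with at most N neutrons each time, the expected gain per unit of
    -- time is at most K = C N times the value of one neutron. Writing `alive` as a probability then
    -- turns the bound back into an integral over the life.
    have hfiss : ∫⁻ m, (if M.Fission x m then
          (M.card x m : ℝ≥0∞) * (c * growth K (t - (M.lifetime x m).toReal)) else 0) ∂noiseLaw ≤
        ∫⁻ m, (∫⁻ s in Set.Ioi 0, if ENNReal.ofReal s < M.lifetime x m then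
          c * (K * growth K (t - s)) else 0) ∂noiseLaw := by
      have hKm : Measurable (Function.uncurry fun (s : ℝ) (z : Velocities) =>
          (z.1 : ℝ≥0∞) * (c * growth K (t - s))) := by
        have h1 : Measurable fun p : ℝ × Velocities => (p.2.1 : ℝ≥0∞) :=
          measurable_from_nat.comp (measurable_velocities_card.comp measurable_snd)
        have h2 : Measurable fun p : ℝ × Velocities => c * growth K (t - p.1) :=
          (hgm.comp (measurable_const.sub measurable_fst)).const_mul _
        exact h1.mul h2
      refine (M.lintegral_fission_of_mem_domain hM hx hKm).trans_le ?_
      have hswap : ∫⁻ m, (∫⁻ s in Set.Ioi 0, if ENNReal.ofReal s < M.lifetime x m then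
          c * (K * growth K (t - s)) else 0) ∂noiseLaw =
          ∫⁻ s in Set.Ioi 0, M.alive x s * (c * (K * growth K (t - s))) := by
        rw [lintegral_lintegral_swap]
        · refine lintegral_congr fun s => ?_
          rw [alive, mul_comm (noiseLaw _), ← lintegral_indicator_const (M.measurableSet_lt_lifetime x s)]
          refine lintegral_congr fun m => ?_
          simp only [Set.indicator_apply, Set.mem_ofPred_eq]
        · refine Measurable.aemeasurable (Measurable.ite ?_ ?_ measurable_const)
          · exact measurableSet_lt measurable_snd.ennreal_ofReal
              ((M.measurable_lifetime_right x).comp measurable_fst)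
          · have h1 : Measurable fun s => c * (K * growth K (t - s)) :=
              ((hgm.comp (measurable_const.sub measurable_id)).const_mul _).const_mul _
            have h2 : Measurable fun p : Noise × ℝ => p.2 := measurable_snd
            have h3 := h1.comp h2
            exact h3
      rw [hswap]
      refine (setLIntegral_mono' measurableSet_Ioo fun s hs => ?_).trans
        (lintegral_mono_set Set.Ioo_subset_Ioi_self)
      have hmem := M.flow_mem_domain hx hs
      refine mul_le_mul' le_rfl ?_
      calc (M.σf (flow x s) : ℝ≥0∞) * ∫⁻ z, (z.1 : ℝ≥0∞) * (c * growth K (t - s))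
            ∂(M.fission (flow x s))
          ≤ C * ∫⁻ _, (N : ℝ≥0∞) * (c * growth K (t - s)) ∂(M.fission (flow x s)) := by
            refine mul_le_mul' (by exact_mod_cast hC _ hmem) (lintegral_mono_ae ?_)
            filter_upwards [hN _ hmem] with z hz
            gcongr
        _ = c * (K * growth K (t - s)) := by
            rw [lintegral_const, measure_univ, mul_one, hK]
            push_cast
            ring
    -- Without fission there is at most one successor, paid for by the first integral. After a
    -- fission this integral is a harmless excess.
    have hbranch : M.branch (M.mean n h) t x ≤
        ∫⁻ m, c * growth K (t - (M.lifetime x m).toReal) ∂noiseLaw +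
        ∫⁻ m, (if M.Fission x m then
          (M.card x m : ℝ≥0∞) * (c * growth K (t - (M.lifetime x m).toReal)) else 0) ∂noiseLaw := by
      refine (M.branch_mono hM hx (Ψ := fun s _ => c * growth K s) ih t).trans ?_
      rw [M.branch_const (fun s => c * growth K s), ← lintegral_add_left (hlife.const_mul _)]
      refine lintegral_mono fun m => ?_
      simp only
      split_ifs with hF
      · exact le_add_self
      · rw [add_zero]
        have h1 : (M.card x m : ℝ≥0∞) ≤ 1 := by exact_mod_cast M.card_le_one_of_not_fission hF
        calc _ ≤ 1 * (c * growth K (t - (M.lifetime x m).toReal)) := by gcongr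
          _ = _ := one_mul _
    rw [Nat.cast_succ, M.mean_succ hh]
    calc M.firstMean h t x + M.branch (M.mean n h) t x
        ≤ M.firstMean h t x + (∫⁻ m, c * growth K (t - (M.lifetime x m).toReal) ∂noiseLaw +
          ∫⁻ m, (∫⁻ s in Set.Ioi 0, if ENNReal.ofReal s < M.lifetime x m then
            c * (K * growth K (t - s)) else 0) ∂noiseLaw) := by
          gcongr
          exact hbranch.trans (by gcongr)
      _ = ∫⁻ m, (M.first h t x m + (c * growth K (t - (M.lifetime x m).toReal) +
          ∫⁻ s in Set.Ioi 0, (if ENNReal.ofReal s < M.lifetime x m then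
            c * (K * growth K (t - s)) else 0))) ∂noiseLaw := by
          rw [lintegral_add_left (M.measurable_first t x), lintegral_add_left (hlife.const_mul _)]
          rfl
      _ ≤ ∫⁻ _, c * growth K t ∂noiseLaw := lintegral_mono fun m => M.first_add_le hc K ht hx m
      _ = c * growth K t := by simp

theorem mean_top_le_growth (hM : M.BoundedCrossSections) {C : ℝ≥0} {N : ℕ}
    (hC : ∀ y ∈ M.domain, M.σf y ≤ C) (hN : ∀ y ∈ M.domain, ∀ᵐ z ∂(M.fission y), z.1 ≤ N)
    {h : Phase → ℝ≥0∞} (hh : Measurable h) {c : ℝ≥0} (hc : ∀ y ∈ M.domain, h y ≤ c)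
    (t : ℝ) {x : Phase} (hx : x ∈ M.domain) : M.mean ⊤ h t x ≤ c * growth (C * N) t := by
  rw [← M.iSup_mean hh]
  exact iSup_le fun n => M.mean_le_growth hM hC hN hh hc n t x hx

/-- There are at most N² pairs, each contributing at most a b. The bounds on D × V may be used
because the released velocities almost surely lie in V. -/
theorem η_le {C a b : ℝ≥0} {N : ℕ} {x : Phase} (hx : x ∈ M.domain) (hC : M.σf x ≤ C)
    (hN : ∀ᵐ z ∂(M.fission x), z.1 ≤ N) {Φ Ψ : Phase → ℝ≥0∞} (hΦ : ∀ y ∈ M.domain, Φ y ≤ a)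
    (hΨ : ∀ y ∈ M.domain, Ψ y ≤ b) : M.η Φ Ψ x ≤ (C * (N * (N * (a * b))) : ℝ≥0) := by
  have hint : ∫⁻ z, (∑ i, ∑ j, if i ≠ j then Φ (x.1, z.2 i) * Ψ (x.1, z.2 j) else 0)
      ∂(M.fission x) ≤ ∫⁻ _, (N : ℝ≥0∞) * (N * (a * b)) ∂(M.fission x) := by
    refine lintegral_mono_ae ?_
    filter_upwards [hN, M.ae_vel_mem hx] with z hz hV
    have hmem : ∀ i : Fin z.1, (x.1, z.2 i) ∈ M.domain := fun i =>
      ⟨hx.1, by simpa [vel_fin] using hV i i.2⟩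
    calc (∑ i, ∑ j, if i ≠ j then Φ (x.1, z.2 i) * Ψ (x.1, z.2 j) else 0)
        ≤ ∑ _i : Fin z.1, ∑ _j : Fin z.1, (a : ℝ≥0∞) * b := by
          refine Finset.sum_le_sum fun i _ => Finset.sum_le_sum fun j _ => ?_
          split_ifs
          · exact mul_le_mul' (hΦ _ (hmem i)) (hΨ _ (hmem j))
          · exact zero_le
      _ = (z.1 : ℝ≥0∞) * (z.1 * (a * b)) := by simp
      _ ≤ (N : ℝ≥0∞) * (N * (a * b)) := by gcongr
  unfold η
  calc _ ≤ (C : ℝ≥0∞) * ∫⁻ _, (N : ℝ≥0∞) * (N * (a * b)) ∂(M.fission x) :=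
        mul_le_mul' (by exact_mod_cast hC) hint
    _ = _ := by simp

theorem second_lt_top (hM : M.BoundedCrossSections) (hB : M.BoundedOffspring)
    {f g : Phase → ℝ≥0∞} (hf : Measurable f) (hg : Measurable g) {a b : ℝ≥0}
    (hfa : ∀ y ∈ M.domain, f y ≤ a) (hgb : ∀ y ∈ M.domain, g y ≤ b) (t : ℝ) {x : Phase}
    (hx : x ∈ M.domain) : M.second ⊤ f g t x < ∞ := by
  obtain ⟨N, hN⟩ := hB
  obtain ⟨C, hC⟩ : ∃ C : ℝ≥0, ∀ y ∈ M.domain, M.σf y ≤ C := by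
    obtain ⟨C, hC⟩ := hM
    exact ⟨C, fun y hy => (hC y hy).2.1⟩
  have hmf : Measurable (Function.uncurry (M.mean ⊤ f)) := M.measurable_mean_of_measurable hf ⊤
  have hmg : Measurable (Function.uncurry (M.mean ⊤ g)) := M.measurable_mean_of_measurable hg ⊤
  have hH := M.measurable_η hmf hmg
  set E := growth (C * N) t with hE
  have hEt : E ≠ ∞ := growth_ne_top _ _
  rw [M.second_eq_duhamel hM hf hg t hx]
  refine ENNReal.add_lt_top.2 ⟨?_, ?_⟩
  · refine (M.mean_top_le_growth hM hC hN (hf.mul hg) (c := a * b) (fun y hy => ?_) t hx).trans_lt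
      (ENNReal.mul_lt_top ENNReal.coe_lt_top hEt.lt_top)
    push_cast
    exact mul_le_mul' (hfa y hy) (hgb y hy)
  -- This is the bound of `η_le` with a E and b E as bounds for the means at time t - s. Since
  -- `growth` is monotone, its value E at t serves for all times up to t.
  · set c : ℝ≥0 := C * (N * (N * (a * E.toNNReal * (b * E.toNNReal)))) with hc
    have hbound : ∀ s, M.mean ⊤ (fun y => M.η (M.mean ⊤ f (t - s)) (M.mean ⊤ g (t - s)) y) s x ≤
        (Set.Icc 0 t).indicator (fun _ => (c : ℝ≥0∞) * E) s := by
      intro s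
      rcases lt_or_ge s 0 with hs | hs
      · simp [M.mean_of_neg hs]
      have hle : ∀ {k : Phase → ℝ≥0∞} {d : ℝ≥0}, Measurable k → (∀ y ∈ M.domain, k y ≤ d) →
          ∀ y ∈ M.domain, M.mean ⊤ k (t - s) y ≤ (d * E.toNNReal : ℝ≥0) := by
        intro k d hk hd y hy
        refine (M.mean_top_le_growth hM hC hN hk hd _ hy).trans ?_
        rw [ENNReal.coe_mul, ENNReal.coe_toNNReal hEt]
        gcongr
        exact growth_mono _ (by linarith)
      have hηm : Measurable fun y => M.η (M.mean ⊤ f (t - s)) (M.mean ⊤ g (t - s)) y := by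
        have h := hH.comp (measurable_prodMk_left (x := t - s) (β := Phase))
        exact h
      rcases lt_or_ge t s with hts | hts
      · have h2 : M.mean ⊤ f (t - s) = fun _ => 0 := funext fun y => M.mean_of_neg (by linarith)
        simp only [h2, η_zero_left]
        simp [mean_top, ψ]
      · rw [Set.indicator_of_mem (show s ∈ Set.Icc 0 t from ⟨hs, hts⟩)]
        refine (M.mean_top_le_growth hM hC hN hηm (c := c) (fun y hy =>
          M.η_le hy (hC y hy) (hN y hy) (hle hf hfa) (hle hg hgb)) s hx).trans ?_
        gcongr
        exact growth_mono _ hts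
    refine (lintegral_mono hbound).trans_lt ?_
    rw [lintegral_indicator_const measurableSet_Icc, Real.volume_Icc]
    exact ENNReal.mul_lt_top (ENNReal.mul_lt_top ENNReal.coe_lt_top hEt.lt_top)
      ENNReal.ofReal_lt_top

end Model

end Neutron

/-! ### Conclusion for bounded test functions -/

theorem mainTheorem12 (M : Neutron.Model) (hM : M.BoundedCrossSections)
    (f g : Neutron.Phase → ℝ≥0) (hf : Measurable f) (hg : Measurable g)
    (hfb : ∃ C : ℝ≥0, ∀ y ∈ M.domain, f y ≤ C) (hgb : ∃ C : ℝ≥0, ∀ y ∈ M.domain, g y ≤ C)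
    (t : ℝ) (ht : 0 ≤ t) (x : Neutron.Phase) (hx : x ∈ M.domain) :
    (∫⁻ ω, (∫⁻ y, (f y : ℝ≥0∞) ∂(M.X t x ω)) * (∫⁻ y, (g y : ℝ≥0∞) ∂(M.X t x ω))
        ∂Neutron.sampleLaw =
      M.ψ t (fun y => (f y : ℝ≥0∞) * (g y : ℝ≥0∞)) x +
        ∫⁻ s in Set.Icc 0 t,
          M.ψ s (M.η (M.ψ (t - s) fun y => (f y : ℝ≥0∞)) (M.ψ (t - s) fun y => (g y : ℝ≥0∞))) x) ∧
    (M.BoundedOffspring →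
      ∫⁻ ω, (∫⁻ y, (f y : ℝ≥0∞) ∂(M.X t x ω)) * (∫⁻ y, (g y : ℝ≥0∞) ∂(M.X t x ω))
        ∂Neutron.sampleLaw < ∞) := by
  have hf' := hf.coe_nnreal_ennreal
  have hg' := hg.coe_nnreal_ennreal
  have hsecond : M.second ⊤ (fun y => (f y : ℝ≥0∞)) (fun y => (g y : ℝ≥0∞)) t x =
      ∫⁻ ω, (∫⁻ y, (f y : ℝ≥0∞) ∂(M.X t x ω)) * (∫⁻ y, (g y : ℝ≥0∞) ∂(M.X t x ω))
        ∂Neutron.sampleLaw := by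
    simp only [Neutron.Model.second, Neutron.Model.W_top]
  rw [← hsecond]
  constructor
  · rw [M.second_eq_duhamel hM hf' hg' t hx, Neutron.Model.duhamel, M.mean_top,
      M.lintegral_mean_η_eq]
  · intro hB
    obtain ⟨a, ha⟩ := hfb
    obtain ⟨b, hb⟩ := hgb
    exact M.second_lt_top hM hB hf' hg' (fun y hy => by exact_mod_cast ha y hy)
      (fun y hy => by exact_mod_cast hb y hy) t hx
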